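/- Let $n\ge 1$ and let $M$ be a smooth (Hausdorff, second countable) manifold of dimension $2n+1$ with a contact form $\eta$, i.e. a smooth $1$-form such that $\eta\wedge(d\eta)^n$ vanishes nowhere; put $D=\ker\eta$. Suppose $M$ carries a nearly cosymplectic structure $(\phi,\xi,\eta,g)$ with this $\eta$: $g$ is a Riemannian metric, $\phi$ a smooth tensor field of type $(1,1)$ and $\xi$ a smooth vector field such that $$\phi^2=-I+\eta\otimes\xi,\qquad \eta(\xi)=1,\qquad g(\phi X,\phi Y)=g(X,Y)-\eta(X)\eta(Y),$$ and $(\nabla_X\phi)X=0$ for all vector fields $X$, where $\nabla$ is the Levi-Civita connection of $g$. If there are a point $p\in M$ and $c\in\mathbb{R}$ such that the sectional curvature satisfies $K_p(\pi)=c$ for every $2$-plane $\pi\subset D_p$, then $c\neq 0$ and $\dim M=5$. In particular, if $M$ is nonempty, then $g$ is not flat: there is no flat nearly cosymplectic manifold of dimension at least $3$ whose $\eta$ is a contact form. -/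

import Mathlib

open Bundle FiberBundle VectorField
open scoped Manifold ContDiff

set_option linter.unusedSectionVars false

noncomputable section

namespace RiemGeom

variable {E : Type*} [NormedAddCommGroup E] [NormedSpace ℝ E] [FiniteDimensional ℝ E]
  {H : Type*} [TopologicalSpace H] {I : ModelWithCorners ℝ E H}
  {M : Type*} [TopologicalSpace M] [ChartedSpace H M] [IsManifold I ∞ M]
  [RiemannianBundle (fun x : M => TangentSpace I x)]
  [IsContMDiffRiemannianBundle I ∞ E (fun x : M => TangentSpace I x)]

/-! ### The Levi-Civita connection

The Riemannian metric `g` on `M` is the smoothly varying family of inner products on the tangent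
spaces. The Levi-Civita connection is built from the Koszul formula; it is metric and
torsion-free (`leviCivita_metric`, `leviCivita_torsion`). -/

/-- The Koszul expression: half of
`X g(Y,Z) + Y g(X,Z) - Z g(X,Y) + g([X,Y],Z) - g([X,Z],Y) - g([Y,Z],X)`. -/
def koszul (Y X Z : Π x : M, TangentSpace I x) (x : M) : ℝ :=
  (1 / 2) * (d% (fun y : M => inner ℝ (Y y) (Z y)) x (X x)
    + d% (fun y : M => inner ℝ (X y) (Z y)) x (Y x)
    - d% (fun y : M => inner ℝ (X y) (Y y)) x (Z x)
    + inner ℝ (mlieBracket I X Y x) (Z x)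
    - inner ℝ (mlieBracket I X Z x) (Y x)
    - inner ℝ (mlieBracket I Y Z x) (X x))

theorem mdiff_inner {Y Z : Π x : M, TangentSpace I x} {x : M}
    (hY : MDiffAt (T% Y) x) (hZ : MDiffAt (T% Z) x) :
    MDiffAt (fun y : M => (inner ℝ (Y y) (Z y) : ℝ)) x :=
  MDifferentiableAt.inner_bundle (E := fun x : M => TangentSpace I x) hY hZ

theorem koszul_tensorial₁ {Y Z : Π x : M, TangentSpace I x} {x : M}
    (hY : MDiffAt (T% Y) x) (hZ : MDiffAt (T% Z) x) :
    TensorialAt I E (fun X => koszul Y X Z x) x where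
  smul {f X} hf hX := by
    have h1 : (fun y : M => inner ℝ ((f • X) y) (Z y)) = f * fun y => inner ℝ (X y) (Z y) := by
      ext y; simp [inner_smul_left]
    have h2 : (fun y : M => inner ℝ ((f • X) y) (Y y)) = f * fun y => inner ℝ (X y) (Y y) := by
      ext y; simp [inner_smul_left]
    simp only [koszul, h1, h2, mvfderiv_mul hf (mdiff_inner hX hZ),
      mvfderiv_mul hf (mdiff_inner hX hY), mlieBracket_smul_left hf hX]
    simp [inner_add_left, inner_smul_left, inner_smul_right]
    ring
  add {X X'} hX hX' := by
    have h1 : (fun y : M => inner ℝ ((X + X') y) (Z y))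
        = (fun y => inner ℝ (X y) (Z y)) + fun y => inner ℝ (X' y) (Z y) := by
      ext y; simp [inner_add_left]
    have h2 : (fun y : M => inner ℝ ((X + X') y) (Y y))
        = (fun y => inner ℝ (X y) (Y y)) + fun y => inner ℝ (X' y) (Y y) := by
      ext y; simp [inner_add_left]
    simp only [koszul, h1, h2, mvfderiv_add (mdiff_inner hX hZ) (mdiff_inner hX' hZ),
      mvfderiv_add (mdiff_inner hX hY) (mdiff_inner hX' hY), mlieBracket_add_left hX hX']
    simp [inner_add_left, inner_add_right]
    ring

theorem koszul_tensorial₂ {Y X : Π x : M, TangentSpace I x} {x : M}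
    (hY : MDiffAt (T% Y) x) (hX : MDiffAt (T% X) x) :
    TensorialAt I E (fun Z => koszul Y X Z x) x where
  smul {f Z} hf hZ := by
    have h1 : (fun y : M => inner ℝ (X y) ((f • Z) y)) = f * fun y => inner ℝ (X y) (Z y) := by
      ext y; simp [inner_smul_right]
    have h2 : (fun y : M => inner ℝ (Y y) ((f • Z) y)) = f * fun y => inner ℝ (Y y) (Z y) := by
      ext y; simp [inner_smul_right]
    simp only [koszul, h1, h2, mvfderiv_mul hf (mdiff_inner hX hZ),
      mvfderiv_mul hf (mdiff_inner hY hZ), mlieBracket_smul_right hf hZ]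
    simp [inner_add_left, inner_smul_left, inner_smul_right]
    rw [real_inner_comm (X x) (Z x), real_inner_comm (Y x) (Z x)]
    ring
  add {Z Z'} hZ hZ' := by
    have h1 : (fun y : M => inner ℝ (X y) ((Z + Z') y))
        = (fun y => inner ℝ (X y) (Z y)) + fun y => inner ℝ (X y) (Z' y) := by
      ext y; simp [inner_add_right]
    have h2 : (fun y : M => inner ℝ (Y y) ((Z + Z') y))
        = (fun y => inner ℝ (Y y) (Z y)) + fun y => inner ℝ (Y y) (Z' y) := by
      ext y; simp [inner_add_right]
    simp only [koszul, h1, h2, mvfderiv_add (mdiff_inner hX hZ) (mdiff_inner hX hZ'),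
      mvfderiv_add (mdiff_inner hY hZ) (mdiff_inner hY hZ'), mlieBracket_add_right hZ hZ']
    simp [inner_add_left, inner_add_right]
    ring

instance instFiniteDimensionalTangent (x : M) : FiniteDimensional ℝ (TangentSpace I x) := inferInstanceAs (FiniteDimensional ℝ E)

open Classical in
/-- The endomorphism `v ↦ ∇_v Y` of `T_x M`, determined by `g(∇_X Y, Z) = koszul Y X Z` for `Y`
differentiable at `x` (and set to zero otherwise). -/
def leviCivitaFun (Y : Π x : M, TangentSpace I x) (x : M) :
    TangentSpace I x →L[ℝ] TangentSpace I x :=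
  if hY : MDiffAt (T% Y) x then
    haveI : CompleteSpace (TangentSpace I x) := FiniteDimensional.complete ℝ _
    InnerProductSpace.continuousLinearMapOfBilin (𝕜 := ℝ) (E := TangentSpace I x)
      (TensorialAt.mkHom₂ (fun X Z => koszul Y X Z x) x
        (fun _ hZ => koszul_tensorial₁ hY hZ) (fun _ hX => koszul_tensorial₂ hY hX))
  else 0

theorem inner_leviCivitaFun {X Y Z : Π x : M, TangentSpace I x} {x : M}
    (hX : MDiffAt (T% X) x) (hY : MDiffAt (T% Y) x) (hZ : MDiffAt (T% Z) x) :
    inner ℝ (leviCivitaFun Y x (X x)) (Z x) = koszul Y X Z x := by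
  have : CompleteSpace (TangentSpace I x) := FiniteDimensional.complete ℝ _
  rw [leviCivitaFun, dif_pos hY, InnerProductSpace.continuousLinearMapOfBilin_apply]
  exact TensorialAt.mkHom₂_apply _ _ hX hZ


theorem koszul_add {X Y Y' Z : Π x : M, TangentSpace I x} {x : M}
    (hX : MDiffAt (T% X) x) (hY : MDiffAt (T% Y) x) (hY' : MDiffAt (T% Y') x)
    (hZ : MDiffAt (T% Z) x) :
    koszul (Y + Y') X Z x = koszul Y X Z x + koszul Y' X Z x := by
  have h1 : (fun y : M => inner ℝ ((Y + Y') y) (Z y))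
      = (fun y => inner ℝ (Y y) (Z y)) + fun y => inner ℝ (Y' y) (Z y) := by
    ext y; simp [inner_add_left]
  have h2 : (fun y : M => inner ℝ (X y) ((Y + Y') y))
      = (fun y => inner ℝ (X y) (Y y)) + fun y => inner ℝ (X y) (Y' y) := by
    ext y; simp [inner_add_right]
  simp only [koszul, h1, h2, mvfderiv_add (mdiff_inner hY hZ) (mdiff_inner hY' hZ),
    mvfderiv_add (mdiff_inner hX hY) (mdiff_inner hX hY'), mlieBracket_add_left hY hY',
    mlieBracket_add_right hY hY']
  simp [inner_add_left, inner_add_right]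
  ring

theorem koszul_smul {X Y Z : Π x : M, TangentSpace I x} {f : M → ℝ} {x : M}
    (hX : MDiffAt (T% X) x) (hY : MDiffAt (T% Y) x) (hZ : MDiffAt (T% Z) x)
    (hf : MDiffAt f x) :
    koszul (f • Y) X Z x = f x * koszul Y X Z x + d% f x (X x) * inner ℝ (Y x) (Z x) := by
  have h1 : (fun y : M => inner ℝ ((f • Y) y) (Z y)) = f * fun y => inner ℝ (Y y) (Z y) := by
    ext y; simp [inner_smul_left]
  have h2 : (fun y : M => inner ℝ (X y) ((f • Y) y)) = f * fun y => inner ℝ (X y) (Y y) := by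
    ext y; simp [inner_smul_right]
  simp only [koszul, h1, h2, mvfderiv_mul hf (mdiff_inner hY hZ),
    mvfderiv_mul hf (mdiff_inner hX hY), mlieBracket_smul_left hf hY,
    mlieBracket_smul_right hf hY]
  simp [inner_add_left, inner_smul_left, inner_smul_right]
  rw [real_inner_comm (X x) (Y x)]
  ring

theorem ext_inner_extend {x : M} {A B : TangentSpace I x →L[ℝ] TangentSpace I x}
    (h : ∀ X Z : Π y : M, TangentSpace I y, MDiffAt (T% X) x → MDiffAt (T% Z) x →
      (inner ℝ (A (X x)) (Z x) : ℝ) = inner ℝ (B (X x)) (Z x)) : A = B := by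
  ext1 v
  refine ext_inner_right ℝ fun w => ?_
  simpa using h (extend E v) (extend E w) (mdifferentiableAt_extend ..)
    (mdifferentiableAt_extend ..)

/-- The Levi-Civita connection of the Riemannian metric; `leviCivita Y x v` is `∇_v Y`. -/
def leviCivita : CovariantDerivative I E (fun x : M => TangentSpace I x) where
  toFun := leviCivitaFun
  isCovariantDerivativeOnUniv :=
    { add := fun {Y Y' x} hY hY' _ => by
        refine ext_inner_extend fun X Z hX hZ => ?_
        have hs : MDiffAt (T% (Y + Y')) x := mdifferentiableAt_add_section hY hY'
        simp only [add_apply, inner_add_left,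
          inner_leviCivitaFun hX hs hZ, inner_leviCivitaFun hX hY hZ,
          inner_leviCivitaFun hX hY' hZ, koszul_add hX hY hY' hZ]
      leibniz := fun {Y f x} hY hf _ => by
        refine ext_inner_extend fun X Z hX hZ => ?_
        have hs : MDiffAt (T% (f • Y)) x := hf.smul_section hY
        rw [inner_leviCivitaFun hX hs hZ, koszul_smul hX hY hZ hf]
        simp [inner_add_left, inner_smul_left, inner_leviCivitaFun hX hY hZ] }

/-- `X g(Y,Z) = g(∇_X Y, Z) + g(Y, ∇_X Z)`. -/
theorem leviCivita_metric {X Y Z : Π x : M, TangentSpace I x} {x : M}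
    (hX : MDiffAt (T% X) x) (hY : MDiffAt (T% Y) x) (hZ : MDiffAt (T% Z) x) :
    d% (fun y : M => inner ℝ (Y y) (Z y)) x (X x)
      = inner ℝ (leviCivita Y x (X x)) (Z x) + inner ℝ (Y x) (leviCivita Z x (X x)) := by
  have h1 := inner_leviCivitaFun hX hY hZ
  have h2 := inner_leviCivitaFun hX hZ hY
  change _ = inner ℝ (leviCivitaFun Y x (X x)) (Z x) + inner ℝ (Y x) (leviCivitaFun Z x (X x))
  rw [h1, real_inner_comm, h2]
  have e : (fun y : M => (inner ℝ (Z y) (Y y) : ℝ)) = fun y => inner ℝ (Y y) (Z y) := by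
    ext y; exact real_inner_comm _ _
  simp only [koszul, e, mlieBracket_swap_apply (V := Z) (W := Y), inner_neg_left]
  ring

/-- The torsion of the Levi-Civita connection vanishes. -/
theorem leviCivita_torsion :
    (leviCivita : CovariantDerivative I E (fun x : M => TangentSpace I x)).torsion = 0 := by
  refine (CovariantDerivative.torsion_eq_zero_iff _).2 fun {X Y x} hX hY => ?_
  refine ext_inner_right ℝ fun w => ?_
  have hZ : MDiffAt (T% (extend E w : Π y : M, TangentSpace I y)) x := mdifferentiableAt_extend ..
  have h1 := inner_leviCivitaFun hX hY hZ
  have h2 := inner_leviCivitaFun hY hX hZ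
  change inner ℝ (leviCivitaFun Y x (X x) - leviCivitaFun X x (Y x)) w = _
  rw [extend_apply_self] at h1 h2
  rw [inner_sub_left, h1, h2]
  have e : (fun y : M => (inner ℝ (Y y) (X y) : ℝ)) = fun y => inner ℝ (X y) (Y y) := by
    ext y; exact real_inner_comm _ _
  simp only [koszul, e, mlieBracket_swap_apply (V := Y) (W := X), inner_neg_left,
    extend_apply_self]
  ring

/-! ### Curvature -/

/-- `R(X,Y)Z = ∇_X ∇_Y Z - ∇_Y ∇_X Z - ∇_[X,Y] Z` for vector fields. -/
def curvatureField (X Y Z : Π x : M, TangentSpace I x) (x : M) : TangentSpace I x :=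
  leviCivita (fun y => leviCivita Z y (Y y)) x (X x)
    - leviCivita (fun y => leviCivita Z y (X y)) x (Y x)
    - leviCivita Z x (mlieBracket I X Y x)

/-- The curvature tensor `R(u,v)w` on tangent vectors at `x`, computed on the extensions of
`u`, `v`, `w` to vector fields that are smooth near `x`. -/
def curvature {x : M} (u v w : TangentSpace I x) : TangentSpace I x :=
  curvatureField (extend E u) (extend E v) (extend E w) x

/-- The sectional curvature of the plane spanned by linearly independent `u`, `v`. -/
def sectionalCurvature {x : M} (u v : TangentSpace I x) : ℝ :=
  inner ℝ (curvature u v v) u /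
    (inner ℝ u u * inner ℝ v v - inner ℝ u v ^ 2)

variable (I M) in
/-- The Riemannian metric of `M` is flat. -/
def IsFlat : Prop :=
  ∀ (x : M) (u v w : TangentSpace I x), curvature u v w = 0

/-! ### Contact forms -/

/-- Smoothness of a 1-form. -/
def SmoothOneForm (η : Π x : M, TangentSpace I x →L[ℝ] ℝ) : Prop :=
  ContMDiff I (I.prod 𝓘(ℝ, E →L[ℝ] ℝ)) ∞
    (fun x => TotalSpace.mk' (E →L[ℝ] ℝ) (E := fun x : M => TangentSpace I x →L[ℝ] ℝ) x (η x))

/-- Smoothness of a tensor field of type (1,1). -/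
def SmoothEndomorphism (φ : Π x : M, TangentSpace I x →L[ℝ] TangentSpace I x) : Prop :=
  ContMDiff I (I.prod 𝓘(ℝ, E →L[ℝ] E)) ∞
    (fun x => TotalSpace.mk' (E →L[ℝ] E)
      (E := fun x : M => TangentSpace I x →L[ℝ] TangentSpace I x) x (φ x))

/-- The exterior derivative of a 1-form,
`dη(X,Y) = (X η(Y) - Y η(X) - η([X,Y])) / 2`, on tangent vectors `u`, `v` at `x`, computed on
extensions of `u`, `v` to vector fields that are smooth near `x`. -/
def extDerivOneForm (η : Π x : M, TangentSpace I x →L[ℝ] ℝ) (x : M) (u v : TangentSpace I x) : ℝ :=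
  (1 / 2) * (d% (fun y : M => η y (extend E v y)) x u
    - d% (fun y : M => η y (extend E u y)) x v
    - η x (mlieBracket I (extend E u) (extend E v) x))

/-- The `(2n+1)`-form `η ∧ (dη)^n` at `x`, up to the positive constant factor that depends on the
normalisation of the wedge product: the alternating sum over all permutations `σ` of
`η(v_σ(0)) dη(v_σ(1), v_σ(2)) ⋯ dη(v_σ(2n-1), v_σ(2n))`. -/
def contactVolume (n : ℕ) (η : Π x : M, TangentSpace I x →L[ℝ] ℝ) (x : M)
    (v : Fin (2 * n + 1) → TangentSpace I x) : ℝ :=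
  ∑ σ : Equiv.Perm (Fin (2 * n + 1)), ((Equiv.Perm.sign σ : ℤ) : ℝ) *
    (η x (v (σ 0)) *
      ∏ i : Fin n, extDerivOneForm η x
        (v (σ ⟨2 * (i : ℕ) + 1, by omega⟩)) (v (σ ⟨2 * (i : ℕ) + 2, by omega⟩)))

/-- `η` is a contact form on a manifold of dimension `2n+1`: it is smooth and `η ∧ (dη)^n` vanishes
nowhere. -/
def IsContactForm (n : ℕ) (η : Π x : M, TangentSpace I x →L[ℝ] ℝ) : Prop :=
  SmoothOneForm η ∧ ∀ x : M, ∃ v : Fin (2 * n + 1) → TangentSpace I x, contactVolume n η x v ≠ 0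

/-- The fibre `D_x = ker η_x` of the contact distribution. -/
def contactDistribution (η : Π x : M, TangentSpace I x →L[ℝ] ℝ) (x : M) :
    Submodule ℝ (TangentSpace I x) :=
  LinearMap.ker (η x).toLinearMap

/-! ### Almost contact metric and nearly cosymplectic structures -/

/-- `(φ, ξ, η, g)` is an almost contact metric structure, `g` being the metric of `M`. -/
structure IsAlmostContactMetric (φ : Π x : M, TangentSpace I x →L[ℝ] TangentSpace I x)
    (ξ : Π x : M, TangentSpace I x) (η : Π x : M, TangentSpace I x →L[ℝ] ℝ) : Prop where
  smooth_φ : SmoothEndomorphism φ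
  smooth_ξ : CMDiff ∞ (T% ξ)
  smooth_η : SmoothOneForm η
  φ_sq : ∀ (x : M) (v : TangentSpace I x), φ x (φ x v) = -v + η x v • ξ x
  η_ξ : ∀ x : M, η x (ξ x) = 1
  metric : ∀ (x : M) (u v : TangentSpace I x),
    (inner ℝ (φ x u) (φ x v) : ℝ) = inner ℝ u v - η x u * η x v

/-- `(∇_X φ) Y = ∇_X (φ Y) - φ (∇_X Y)` for vector fields. -/
def covDerivEndo (φ : Π x : M, TangentSpace I x →L[ℝ] TangentSpace I x)
    (X Y : Π x : M, TangentSpace I x) (x : M) : TangentSpace I x :=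
  leviCivita (fun y => φ y (Y y)) x (X x) - φ x (leviCivita Y x (X x))

/-- A nearly cosymplectic structure: an almost contact metric structure with `(∇_X φ) X = 0` for
all smooth vector fields `X`. -/
structure IsNearlyCosymplectic (φ : Π x : M, TangentSpace I x →L[ℝ] TangentSpace I x)
    (ξ : Π x : M, TangentSpace I x) (η : Π x : M, TangentSpace I x →L[ℝ] ℝ) : Prop
    extends IsAlmostContactMetric φ ξ η where
  covDerivEndo_self : ∀ X : Π x : M, TangentSpace I x, CMDiff ∞ (T% X) →
    ∀ x : M, covDerivEndo φ X X x = 0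

end RiemGeom

end

/-! Let `h` be the endomorphism `X ↦ ∇_X ξ` and `T(X,Y,Z) = g((∇_X φ)Y, Z)`. Polarising `(∇_X φ)X =
0` and using that `φ` is skew makes `T` totally skew. Differentiating `φ² = -1 + η ⊗ ξ` then shows
that `h` is skew (so `ξ` is Killing), kills `ξ` and anticommutes with `φ`.

The contact condition enters through `dη(u,v) = g(hu, v)` (`extDerivOneForm_eq`): a horizontal
vector killed by `h` would be a common null vector of `η` and `dη`, so `h`, and with it `φh`, is
injective on `D`. The curvature tensor is annihilated by `φ` acting as a derivation
(`R_φ_derivation`). By the Killing identity the same holds for `∇h`, which therefore vanishes on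
horizontal triples (`κ_horizontal`). Hence both `φ` and `h` can be moved between the slots of `T` on
`D`; as they anticommute, `T(X,Y,φhZ) = 0` (`T_φ_h`). Since `φh` is onto `D`, `T` vanishes on `D`
(`T_eq_zero`).

The Ricci identity for `φ` now involves only `h` (`R_sub_R_φ`). For constant curvature `c` on `D` it
reads, for horizontal `x` and `w`, `c(|x|²|w|² - ⟨x,w⟩² - ⟨x,φw⟩²) = ⟨x,hw⟩² + ⟨x,φhw⟩²`. Taking `x
= hw` with `w ≠ 0` gives `c ≠ 0`. A vector `x` orthogonal to the five mutually orthogonal nonzero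
vectors `ξ, w, φw, hw, φhw` satisfies `c|x|²|w|² = 0`, so these five span the tangent space.
Flatness would be the excluded case `c = 0`. -/

/-! ### Algebraic Riemannian geometry

The vector fields of a Riemannian manifold form a module `V` over the ring `A` of functions, with an
action of `V` on `A` by derivations, a metric and a torsion-free metric connection. The identities
for the curvature tensor, and those of nearly cosymplectic geometry, follow from the calculus rules
alone. -/

/-- A module of vector fields with a metric and its Levi-Civita connection. The bracket is
`∇_X Y - ∇_Y X`. -/
structure RiemannianCalculus (A V : Type*) [CommRing A] [AddCommGroup V] [Module A V] where
  /-- the derivative of a function along a vector field -/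
  d : V → A → A
  /-- the metric -/
  g : V →ₗ[A] V →ₗ[A] A
  /-- the connection -/
  nabla : V → V → V
  d_add : ∀ X f h, d X (f + h) = d X f + d X h
  d_mul : ∀ X f h, d X (f * h) = f * d X h + h * d X f
  g_symm : ∀ X Y, g X Y = g Y X
  g_nondegenerate : ∀ X, (∀ Y, g X Y = 0) → X = 0
  nabla_add_left : ∀ X X' Y, nabla (X + X') Y = nabla X Y + nabla X' Y
  nabla_smul_left : ∀ (f : A) X Y, nabla (f • X) Y = f • nabla X Y
  nabla_add_right : ∀ X Y Y', nabla X (Y + Y') = nabla X Y + nabla X Y'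
  nabla_smul_right : ∀ X (f : A) Y, nabla X (f • Y) = f • nabla X Y + d X f • Y
  d_g : ∀ X Y Z, d X (g Y Z) = g (nabla X Y) Z + g Y (nabla X Z)
  jacobi : ∀ X Y Z,
    nabla X (nabla Y Z - nabla Z Y) - nabla (nabla Y Z - nabla Z Y) X =
      nabla (nabla X Y - nabla Y X) Z - nabla Z (nabla X Y - nabla Y X) +
        (nabla Y (nabla X Z - nabla Z X) - nabla (nabla X Z - nabla Z X) Y)

namespace RiemannianCalculus

variable {A V : Type*} [CommRing A] [AddCommGroup V] [Module A V] (C : RiemannianCalculus A V)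

theorem d_zero (X : V) : C.d X 0 = 0 := by
  have := C.d_add X 0 0
  simpa using this

theorem d_neg (X : V) (f : A) : C.d X (-f) = -C.d X f := by
  have := C.d_add X f (-f)
  rw [add_neg_cancel, d_zero] at this
  linear_combination -this

theorem d_one (X : V) : C.d X 1 = 0 := by
  have := C.d_mul X 1 1
  simpa using this

theorem nabla_zero_right (X : V) : C.nabla X 0 = 0 := by
  simpa using C.nabla_add_right X 0 0

theorem nabla_zero_left (Y : V) : C.nabla 0 Y = 0 := by
  simpa using C.nabla_add_left 0 0 Y

theorem nabla_neg_right (X Y : V) : C.nabla X (-Y) = -C.nabla X Y := by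
  have := C.nabla_add_right X Y (-Y)
  rw [add_neg_cancel, nabla_zero_right] at this
  exact (neg_eq_of_add_eq_zero_right this.symm).symm

theorem nabla_neg_left (X Y : V) : C.nabla (-X) Y = -C.nabla X Y := by
  have := C.nabla_add_left X (-X) Y
  rw [add_neg_cancel, nabla_zero_left] at this
  exact (neg_eq_of_add_eq_zero_right this.symm).symm

theorem nabla_sub_right (X Y Z : V) : C.nabla X (Y - Z) = C.nabla X Y - C.nabla X Z := by
  rw [sub_eq_add_neg, C.nabla_add_right, nabla_neg_right, sub_eq_add_neg]

theorem nabla_sub_left (X Y Z : V) : C.nabla (X - Y) Z = C.nabla X Z - C.nabla Y Z := by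
  rw [sub_eq_add_neg, C.nabla_add_left, nabla_neg_left, sub_eq_add_neg]

theorem eq_of_g {X Y : V} (h : ∀ Z, C.g X Z = C.g Y Z) : X = Y :=
  sub_eq_zero.1 (C.g_nondegenerate _ fun Z => by simp [h])

/-- The value `d X f` is the `ξ`-component of `∇_X (fξ) - f ∇_X ξ`, so linearity of `d` in the field
is inherited from `nabla`. -/
theorem d_sub_left {ξ : V} (hξ : C.g ξ ξ = 1) (X Y : V) (f : A) :
    C.d (X - Y) f = C.d X f - C.d Y f := by
  have h := congrArg (fun v => C.g v ξ) (C.nabla_sub_left X Y (f • ξ))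
  have h' := congrArg (fun v => C.g v ξ) (C.nabla_sub_left X Y ξ)
  simp only [C.nabla_smul_right, map_add, map_sub, map_smul, LinearMap.add_apply,
    LinearMap.sub_apply, LinearMap.smul_apply, smul_eq_mul, hξ] at h h'
  linear_combination h - f * h'

/-- The derivation along a bracket is the commutator of derivations, as soon as there is a unit
vector field. -/
theorem d_bracket {ξ : V} (hξ : C.g ξ ξ = 1) (X Y : V) (f : A) :
    C.d (C.nabla X Y - C.nabla Y X) f = C.d X (C.d Y f) - C.d Y (C.d X f) := by
  -- Comparing the Jacobi identity for `fξ` with `f` times the one for `ξ` leaves the second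
  -- derivatives of `f` as coefficient of `ξ`.
  have h0 := C.jacobi X Y ξ
  have h1 := C.jacobi X Y (f • ξ)
  simp only [C.nabla_sub_left, C.nabla_sub_right, C.nabla_smul_right, C.nabla_smul_left,
    C.nabla_add_right, C.nabla_add_left] at h0 h1
  have h0' := congrArg (fun v => C.g v ξ) h0
  have h1' := congrArg (fun v => C.g v ξ) h1
  simp only [map_add, map_sub, map_smul, LinearMap.add_apply, LinearMap.sub_apply,
    LinearMap.smul_apply, smul_eq_mul, hξ] at h0' h1'
  rw [C.d_sub_left hξ]
  linear_combination f * h0' - h1'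

/-- The curvature `R(X,Y)Z`. -/
def curv (X Y Z : V) : V :=
  C.nabla X (C.nabla Y Z) - C.nabla Y (C.nabla X Z) - C.nabla (C.nabla X Y - C.nabla Y X) Z

/-- The curvature tensor `g(R(X,Y)Z,W)`. -/
def R (X Y Z W : V) : A := C.g (C.curv X Y Z) W

theorem R_swap₁₂ (X Y Z W : V) : C.R X Y Z W = -C.R Y X Z W := by
  simp only [R, curv, C.nabla_sub_left, map_sub, LinearMap.sub_apply]
  ring

theorem R_bianchi (X Y Z W : V) : C.R X Y Z W + C.R Y Z X W + C.R Z X Y W = 0 := by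
  have h := congrArg (fun v => C.g v W) (C.jacobi X Y Z)
  simp only [R, curv, C.nabla_sub_left, C.nabla_sub_right, map_sub, LinearMap.sub_apply, map_add,
    LinearMap.add_apply] at h ⊢
  linear_combination h

/-- Apply the commutator formula `d_bracket` to the function `g(Z,W)` and expand with metric
compatibility; the mixed terms cancel. -/
theorem R_swap₃₄ {ξ : V} (hξ : C.g ξ ξ = 1) (X Y Z W : V) : C.R X Y Z W = -C.R X Y W Z := by
  have h := C.d_bracket hξ X Y (C.g Z W)
  simp only [C.d_g, C.d_add] at h
  simp only [R, curv, map_sub, LinearMap.sub_apply] at h ⊢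
  rw [C.g_symm Z, C.g_symm Z, C.g_symm Z] at h
  linear_combination -h

theorem R_add₁ (X X' Y Z W : V) : C.R (X + X') Y Z W = C.R X Y Z W + C.R X' Y Z W := by
  simp only [R, curv, C.nabla_sub_left, C.nabla_add_left, C.nabla_add_right, map_sub, map_add,
    LinearMap.sub_apply, LinearMap.add_apply]
  ring

theorem R_smul₁ (f : A) (X Y Z W : V) : C.R (f • X) Y Z W = f * C.R X Y Z W := by
  simp only [R, curv, C.nabla_sub_left, C.nabla_smul_left, C.nabla_smul_right, map_sub, map_add,
    C.nabla_add_left, map_smul, LinearMap.sub_apply, LinearMap.add_apply, LinearMap.smul_apply,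
    smul_eq_mul]
  ring

variable [IsAddTorsionFree A]

theorem eq_zero_of_two_mul {B : Type*} [CommRing B] [IsAddTorsionFree B] {a : B}
    (h : 2 * a = 0) : a = 0 :=
  nsmul_right_injective two_ne_zero (by simpa using h)

theorem eq_zero_of_three_mul {B : Type*} [CommRing B] [IsAddTorsionFree B] {a : B}
    (h : 3 * a = 0) : a = 0 :=
  nsmul_right_injective three_ne_zero (by simpa using h)

/-- Signed sum of the four Bianchi identities of the cyclic rotations of `X, Y, Z, W`. Functions
cannot be divided by 2 in `A`, so torsion-freeness is used instead. -/
theorem R_pair {ξ : V} (hξ : C.g ξ ξ = 1) (X Y Z W : V) : C.R X Y Z W = C.R Z W X Y := by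
  refine sub_eq_zero.1 (eq_zero_of_two_mul ?_)
  have s := C.R_swap₁₂
  have t := C.R_swap₃₄ hξ
  have b₁ := C.R_bianchi X Y Z W
  have b₂ := C.R_bianchi Y Z W X
  have b₃ := C.R_bianchi Z W X Y
  have b₄ := C.R_bianchi W X Y Z
  rw [s Z X Y W] at b₁
  rw [t Y Z W X, t Z W Y X, s W Y Z X, t Y W Z X] at b₂
  rw [s W X Z Y, t X W Z Y, t X Z W Y] at b₃
  rw [s W X Y Z, t X Y W Z] at b₄
  linear_combination b₁ + b₂ - b₃ - b₄

end RiemannianCalculus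

/-! ### Nearly cosymplectic identities -/

/-- A nearly cosymplectic structure over a calculus of vector fields; the 1-form is the metric dual
of `ξ`. -/
structure NearlyCosymplecticCalculus (A V : Type*) [CommRing A] [AddCommGroup V] [Module A V]
    extends RiemannianCalculus A V where
  /-- the structure tensor -/
  φ : V →ₗ[A] V
  /-- the Reeb field -/
  ξ : V
  g_ξ_ξ : g ξ ξ = 1
  φ_φ : ∀ X, φ (φ X) = -X + g X ξ • ξ
  φ_ξ : φ ξ = 0
  g_φ : ∀ X Y, g (φ X) Y = -g X (φ Y)
  nabla_φ_self : ∀ X, nabla X (φ X) = φ (nabla X X)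

namespace NearlyCosymplecticCalculus

variable {A V : Type*} [CommRing A] [AddCommGroup V] [Module A V]
  (C : NearlyCosymplecticCalculus A V)

theorem g_φ_ξ (X : V) : C.g (C.φ X) C.ξ = 0 := by rw [C.g_φ, C.φ_ξ, map_zero, neg_zero]

/-- The tensor `g((∇_X φ)Y, Z)`. -/
def T (X Y Z : V) : A := C.g (C.nabla X (C.φ Y) - C.φ (C.nabla X Y)) Z

theorem T_add₁ (X X' Y Z : V) : C.T (X + X') Y Z = C.T X Y Z + C.T X' Y Z := by
  simp only [T, C.nabla_add_left, map_add, map_sub, LinearMap.add_apply, LinearMap.sub_apply]; ring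

theorem T_add₂ (X Y Y' Z : V) : C.T X (Y + Y') Z = C.T X Y Z + C.T X Y' Z := by
  simp only [T, C.nabla_add_right, map_add, map_sub, LinearMap.add_apply, LinearMap.sub_apply]; ring

theorem T_sub₁ (X X' Y Z : V) : C.T (X - X') Y Z = C.T X Y Z - C.T X' Y Z := by
  simp only [T, C.nabla_sub_left, map_sub, LinearMap.sub_apply]; ring

theorem T_add₃ (X Y Z Z' : V) : C.T X Y (Z + Z') = C.T X Y Z + C.T X Y Z' := by
  simp only [T, map_add]

theorem T_smul₁ (f : A) (X Y Z : V) : C.T (f • X) Y Z = f * C.T X Y Z := by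
  simp only [T, C.nabla_smul_left, map_smul, ← smul_sub, LinearMap.smul_apply, smul_eq_mul]

theorem T_neg₃ (X Y Z : V) : C.T X Y (-Z) = -C.T X Y Z := by
  simp only [T, map_neg]

theorem T_smul₃ (f : A) (X Y Z : V) : C.T X Y (f • Z) = f * C.T X Y Z := by
  simp only [T, map_smul, smul_eq_mul]

theorem T_swap₁₂ (X Y Z : V) : C.T X Y Z = -C.T Y X Z := by
  have h : ∀ X, C.T X X Z = 0 := fun X => by simp [T, C.nabla_φ_self]
  have := h (X + Y)
  rw [T_add₁, T_add₂, T_add₂, h, h] at this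
  linear_combination this

theorem T_swap₂₃ (X Y Z : V) : C.T X Y Z = -C.T X Z Y := by
  have h : C.d X (C.g (C.φ Y) Z + C.g (C.φ Z) Y) = 0 := by
    rw [C.g_φ, C.g_symm Y, neg_add_cancel, C.d_zero]
  rw [C.d_add, C.d_g, C.d_g] at h
  simp only [T, map_sub, LinearMap.sub_apply]
  rw [C.g_φ, C.g_φ (C.nabla X Z), C.g_symm (C.nabla X Y), C.g_symm (C.nabla X Z)]
  linear_combination h

theorem T_swap₁₃ (X Y Z : V) : C.T X Y Z = -C.T Z Y X := by
  rw [C.T_swap₁₂, C.T_swap₂₃, C.T_swap₁₂, neg_neg]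

/-- The endomorphism `X ↦ ∇_X ξ`. -/
def h (X : V) : V := C.nabla X C.ξ

/-- Covariant derivative of `φ² = -1 + η ⊗ ξ`. -/
theorem T_φ (X Y Z : V) : C.T X (C.φ Y) Z - C.T X Y (C.φ Z) =
    C.g Y (C.h X) * C.g Z C.ξ + C.g Y C.ξ * C.g (C.h X) Z := by
  have e : C.g (C.nabla X (C.φ Y) - C.φ (C.nabla X Y)) (C.φ Z) =
      -C.g (C.φ (C.nabla X (C.φ Y)) - C.φ (C.φ (C.nabla X Y))) Z := by
    rw [← map_sub, C.g_φ, neg_neg]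
  simp only [T, e, h]
  rw [C.φ_φ, C.φ_φ, C.nabla_add_right, C.nabla_neg_right, C.nabla_smul_right, C.d_g]
  simp only [map_add, map_neg, map_sub, map_smul, LinearMap.add_apply, LinearMap.sub_apply,
    LinearMap.neg_apply, LinearMap.smul_apply, smul_eq_mul]
  rw [C.g_symm C.ξ]
  ring

variable [IsAddTorsionFree A]
open RiemannianCalculus

theorem T_right_self (X Y : V) : C.T X Y Y = 0 :=
  eq_zero_of_two_mul (by linear_combination C.T_swap₂₃ X Y Y)

theorem g_h_ξ (X : V) : C.g (C.h X) C.ξ = 0 := by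
  refine eq_zero_of_two_mul ?_
  have := C.d_g X C.ξ C.ξ
  rw [C.g_ξ_ξ, C.d_one, C.g_symm C.ξ] at this
  rw [h]
  linear_combination -this

theorem T_ξ_φ (X Z : V) : C.T X C.ξ (C.φ Z) = -C.g (C.h X) Z := by
  have := C.T_φ X C.ξ Z
  rw [C.φ_ξ, C.g_symm C.ξ, C.g_h_ξ, C.g_ξ_ξ] at this
  have e : C.T X 0 Z = 0 := by simp [T, C.nabla_zero_right]
  linear_combination -this + e

/-- Total skewness kills `T(ξ,ξ,φZ)`, which `T_ξ_φ` identifies with `-g(hξ,Z)`. -/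
theorem h_ξ : C.h C.ξ = 0 :=
  C.g_nondegenerate _ fun Z => by
    have := C.T_ξ_φ C.ξ Z
    have e : C.T C.ξ C.ξ (C.φ Z) = 0 := by rw [C.T_swap₁₃, C.T_right_self, neg_zero]
    rwa [e, eq_comm, neg_eq_zero] at this

theorem T_ξ_swap_φ (Y Z : V) : C.T C.ξ (C.φ Y) Z = C.T C.ξ Y (C.φ Z) := by
  have := C.T_φ C.ξ Y Z
  rw [h_ξ] at this
  simpa [sub_eq_zero] using this

theorem g_h_eq (X Y : V) : C.g (C.h X) Y = C.T C.ξ X (C.φ Y) := by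
  rw [C.T_swap₁₂, T_ξ_φ, neg_neg]

/-- `ξ` is a Killing field. -/
theorem g_h (X Y : V) : C.g (C.h X) Y = -C.g X (C.h Y) := by
  rw [C.g_symm X, g_h_eq, g_h_eq, ← T_ξ_swap_φ, C.T_swap₂₃]

theorem T_φ_φ (X Y Z : V) (hZ : C.T X Y C.ξ = 0) : C.T X Y (C.φ (C.φ Z)) = -C.T X Y Z := by
  rw [C.φ_φ, T_add₃, T_neg₃, T_smul₃, hZ]; ring

theorem T_ξ_ξ (X : V) : C.T C.ξ X C.ξ = 0 := by
  rw [C.T_swap₁₂, C.T_right_self, neg_zero]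

/-- `h` anticommutes with `φ`. -/
theorem h_φ (X : V) : C.h (C.φ X) = -C.φ (C.h X) :=
  C.eq_of_g fun Y => by
    rw [map_neg, LinearMap.neg_apply, C.g_φ, g_h_eq, g_h_eq, T_ξ_swap_φ, neg_neg]

theorem T_ξ (X Z : V) : C.T X Z C.ξ = C.g (C.φ (C.h X)) Z := by
  rw [C.g_φ, g_h_eq, C.T_φ_φ _ _ _ (C.T_ξ_ξ _), C.T_swap₂₃, C.T_swap₁₂]

/-- The covariant derivative of the tensor `T`. -/
def S (W X Y Z : V) : A :=
  C.d W (C.T X Y Z) - C.T (C.nabla W X) Y Z - C.T X (C.nabla W Y) Z - C.T X Y (C.nabla W Z)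

theorem S_swap₂₃ (W X Y Z : V) : C.S W X Y Z = -C.S W Y X Z := by
  simp only [S]
  rw [C.T_swap₁₂ X Y, C.T_swap₁₂ (C.nabla W X), C.T_swap₁₂ X (C.nabla W Y),
    C.T_swap₁₂ X Y (C.nabla W Z), C.d_neg]
  ring

theorem S_swap₃₄ (W X Y Z : V) : C.S W X Y Z = -C.S W X Z Y := by
  simp only [S]
  rw [C.T_swap₂₃ X Y, C.T_swap₂₃ (C.nabla W X), C.T_swap₂₃ X (C.nabla W Y),
    C.T_swap₂₃ X Y (C.nabla W Z), C.d_neg]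
  ring

/-- The Ricci identity for `φ`. -/
theorem R_φ (W X Y Z : V) :
    C.R W X (C.φ Y) Z + C.R W X Y (C.φ Z) = C.S W X Y Z - C.S X W Y Z := by
  have e : C.R W X Y (C.φ Z) = -C.g (C.φ (C.curv W X Y)) Z := by rw [C.g_φ, neg_neg]; rfl
  rw [e]
  simp only [S, T, C.d_g]
  simp only [R, curv, C.nabla_sub_left, C.nabla_sub_right, map_sub, LinearMap.sub_apply]
  ring

/-- By the Ricci identity and pair symmetry the left side is an alternating sum of `∇T`, hence
unchanged when `X, Y, Z` are permuted cyclically. By the Bianchi identity its cyclic sum is zero, so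
three times it vanishes. -/
theorem R_φ_derivation (W X Y Z : V) :
    C.R (C.φ W) X Y Z + C.R W (C.φ X) Y Z + C.R W X (C.φ Y) Z + C.R W X Y (C.φ Z) = 0 := by
  have key : ∀ W X Y Z, C.R (C.φ W) X Y Z + C.R W (C.φ X) Y Z + C.R W X (C.φ Y) Z
      + C.R W X Y (C.φ Z) =
      C.S W X Y Z - C.S X W Y Z + C.S Y W X Z - C.S Z W X Y := fun W X Y Z => by
    rw [C.R_pair C.g_ξ_ξ (C.φ W), C.R_pair C.g_ξ_ξ W (C.φ X), add_assoc, R_φ, R_φ,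
      C.S_swap₂₃ Y Z W X, C.S_swap₃₄ Y W Z X, C.S_swap₂₃ Z Y W X, C.S_swap₃₄ Z W Y X]
    ring
  refine eq_zero_of_three_mul ?_
  have k₁ := key W X Y Z
  have k₂ := key W Y Z X
  have k₃ := key W Z X Y
  have e₁ : C.S W Y Z X = C.S W X Y Z := by rw [C.S_swap₃₄, C.S_swap₂₃, neg_neg]
  have e₂ : C.S W Z X Y = C.S W X Y Z := by rw [C.S_swap₂₃, C.S_swap₃₄, neg_neg]
  rw [e₁, C.S_swap₃₄ Y W Z X, C.S_swap₃₄ Z W Y X] at k₂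
  rw [e₂, C.S_swap₃₄ X W Z Y, C.S_swap₃₄ Y W Z X] at k₃
  have t := C.R_swap₃₄ C.g_ξ_ξ
  have s := C.R_swap₁₂
  have b : ∀ W X Y Z, C.R W X Y Z + C.R W Y Z X + C.R W Z X Y = 0 := fun W X Y Z => by
    rw [C.R_pair C.g_ξ_ξ W X, C.R_pair C.g_ξ_ξ W Y, C.R_pair C.g_ξ_ξ W Z, t Y, t Z, t X]
    linear_combination -C.R_bianchi Y Z X W
  have b₀ := b (C.φ W) X Y Z
  have b₁ := b W (C.φ X) Y Z
  have b₂ := b W X (C.φ Y) Z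
  have b₃ := b W X Y (C.φ Z)
  linear_combination 2 * k₁ - k₂ - k₃ + b₀ + b₁ + b₂ + b₃

/-! ### Second derivative of the Killing field `ξ` -/

/-- The second covariant derivative of the Killing field `ξ`. -/
def κ (X Y Z : V) : A := C.g (C.nabla X (C.h Y) - C.h (C.nabla X Y)) Z

theorem κ_swap₂₃ (X Y Z : V) : C.κ X Y Z = -C.κ X Z Y := by
  have e : C.d X (C.g (C.h Y) Z + C.g (C.h Z) Y) = 0 := by
    rw [C.g_h, C.g_symm Y, neg_add_cancel, C.d_zero]
  rw [C.d_add, C.d_g, C.d_g] at e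
  simp only [κ, map_sub, LinearMap.sub_apply]
  rw [C.g_h, C.g_h (C.nabla X Z), C.g_symm (C.nabla X Y), C.g_symm (C.nabla X Z)]
  linear_combination e

theorem κ_sub (X Y Z : V) : C.κ X Y Z - C.κ Y X Z = C.R X Y C.ξ Z := by
  simp only [κ, R, curv, h, C.nabla_sub_left, map_sub, LinearMap.sub_apply]
  ring

/-- The Killing identity: `κ` is skew in its last two arguments and its skew part in the first two
is curvature, so, as in the Koszul formula, a signed sum over cyclic permutations isolates `κ`. -/
theorem κ_eq (X Y Z : V) : C.κ X Y Z = C.R X C.ξ Y Z := by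
  refine sub_eq_zero.1 (eq_zero_of_two_mul ?_)
  have k₁ := C.κ_sub X Y Z
  have k₂ := C.κ_sub Y Z X
  have k₃ := C.κ_sub Z X Y
  rw [C.κ_swap₂₃ Y X Z] at k₁
  rw [C.κ_swap₂₃ Z Y X] at k₂
  rw [C.κ_swap₂₃ X Z Y] at k₃
  have b := C.R_bianchi X Y Z C.ξ
  rw [C.R_pair C.g_ξ_ξ X C.ξ, C.R_swap₃₄ C.g_ξ_ξ Y Z X C.ξ]
  rw [C.R_swap₃₄ C.g_ξ_ξ _ _ _ C.ξ, C.R_swap₃₄ C.g_ξ_ξ Y Z _ C.ξ,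
    C.R_swap₃₄ C.g_ξ_ξ Z X _ C.ξ] at b
  linear_combination k₁ - k₂ + k₃ - b

/-- Put `ξ` in the second slot of `R_φ_derivation`; the term containing `φξ` drops out. -/
theorem κ_φ_derivation (X Y Z : V) :
    C.κ (C.φ X) Y Z + C.κ X (C.φ Y) Z + C.κ X Y (C.φ Z) = 0 := by
  have := C.R_φ_derivation X C.ξ Y Z
  rw [C.φ_ξ] at this
  have e : C.R X 0 Y Z = 0 := by
    simp [R, curv, C.nabla_zero_left, C.nabla_zero_right]
  simp only [κ_eq]
  linear_combination this - e

/-- Covariant derivative of the relation `hφ = -φh`. -/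
theorem κ_φ (X Y Z : V) :
    C.κ X (C.φ Y) Z - C.κ X Y (C.φ Z) = C.T X Y (C.h Z) - C.T X (C.h Y) Z := by
  have e₁ : C.κ X Y (C.φ Z) = -C.g (C.φ (C.nabla X (C.h Y) - C.h (C.nabla X Y))) Z := by
    rw [C.g_φ, neg_neg]; rfl
  have e₂ : C.T X Y (C.h Z) = -C.g (C.h (C.nabla X (C.φ Y) - C.φ (C.nabla X Y))) Z := by
    rw [C.g_h, neg_neg]; rfl
  have e₃ : C.h (C.nabla X (C.φ Y) - C.φ (C.nabla X Y)) =
      C.h (C.nabla X (C.φ Y)) + C.φ (C.h (C.nabla X Y)) := by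
    rw [h, C.nabla_sub_left, ← h, ← h, h_φ, sub_neg_eq_add]
  rw [e₁, e₂, e₃]
  simp only [κ, T, h_φ, C.nabla_neg_right, map_sub, map_neg, map_add, LinearMap.sub_apply,
    LinearMap.neg_apply, LinearMap.add_apply]
  ring

/-! ### Vanishing on the horizontal distribution -/

/-- A vector field is horizontal if it lies in the kernel of the 1-form. -/
def Horizontal (X : V) : Prop := C.g X C.ξ = 0

theorem horizontal_φ (X : V) : C.Horizontal (C.φ X) := C.g_φ_ξ X

theorem horizontal_h (X : V) : C.Horizontal (C.h X) := C.g_h_ξ X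

variable {C}

theorem Horizontal.φ_φ {X : V} (hX : C.Horizontal X) : C.φ (C.φ X) = -X := by
  rw [C.φ_φ, hX, zero_smul, add_zero]

/-- On horizontal triples, inserting `φ` in the three slots gives commuting operators of square
`-1`. Their sum has eigenvalues `±i, ±3i`, so it is injective, and it kills `κ` by `κ_φ_derivation`.
The combination below is this argument without complex scalars. -/
theorem κ_horizontal {X Y Z : V} (hX : C.Horizontal X) (hY : C.Horizontal Y)
    (hZ : C.Horizontal Z) : C.κ X Y Z = 0 := by
  have n₁ : ∀ Y Z, C.κ (-X) Y Z = -C.κ X Y Z := fun Y Z => by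
    simp only [κ, h, C.nabla_neg_left, ← neg_sub', map_neg, LinearMap.neg_apply]
  have n₂ : ∀ X Z, C.κ X (-Y) Z = -C.κ X Y Z := fun X Z => by
    simp only [κ, h, C.nabla_neg_left, C.nabla_neg_right, ← neg_sub', map_neg, LinearMap.neg_apply]
  have n₃ : ∀ X Y, C.κ X Y (-Z) = -C.κ X Y Z := fun X Y => by simp only [κ, map_neg]
  have k₁ := C.κ_φ_derivation (C.φ X) Y Z
  have k₂ := C.κ_φ_derivation X (C.φ Y) Z
  have k₃ := C.κ_φ_derivation X Y (C.φ Z)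
  have k₄ := C.κ_φ_derivation (C.φ X) (C.φ Y) (C.φ Z)
  rw [hX.φ_φ, n₁] at k₁
  rw [hY.φ_φ, n₂] at k₂
  rw [hZ.φ_φ, n₃] at k₃
  rw [hX.φ_φ, hY.φ_φ, hZ.φ_φ, n₁, n₂, n₃] at k₄
  refine eq_zero_of_three_mul ?_
  linear_combination -k₁ - k₂ - k₃ - 2 * k₄

theorem T_swap_φ {X Y Z : V} (hY : C.Horizontal Y) (hZ : C.Horizontal Z) :
    C.T X (C.φ Y) Z = C.T X Y (C.φ Z) := by
  have := C.T_φ X Y Z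
  rw [hY, hZ] at this
  linear_combination this

theorem T_swap_h {X Y Z : V} (hX : C.Horizontal X) (hY : C.Horizontal Y) (hZ : C.Horizontal Z) :
    C.T X (C.h Y) Z = C.T X Y (C.h Z) := by
  have := C.κ_φ X Y Z
  rw [κ_horizontal hX (C.horizontal_φ Y) hZ, κ_horizontal hX hY (C.horizontal_φ Z)] at this
  linear_combination this

/-- Start from `φh` in the third slot, send `φ` to the second slot and `h` to the first, then bring
back `φ` and last `h`. They return in the order `hφ = -φh`, so the value equals its own negative. -/
theorem T_φ_h {X Y Z : V} (hX : C.Horizontal X) (hY : C.Horizontal Y) (hZ : C.Horizontal Z) :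
    C.T X Y (C.φ (C.h Z)) = 0 := by
  have key : ∀ {X Y Z}, C.Horizontal X → C.Horizontal Y → C.Horizontal Z →
      C.T X Y (C.h Z) = C.T (C.h X) Y Z := fun {X Y Z} hX hY hZ => by
    rw [C.T_swap₁₂ X, C.T_swap₁₂ (C.h X), T_swap_h hY hX hZ]
  refine eq_zero_of_two_mul ?_
  have e : C.T X Y (C.φ (C.h Z)) = -C.T X Y (C.φ (C.h Z)) := by
    conv_lhs => rw [← T_swap_φ hY (C.horizontal_h Z), key hX (C.horizontal_φ Y) hZ,
      T_swap_φ hY hZ, ← key hX hY (C.horizontal_φ Z), h_φ, T_neg₃]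
  linear_combination e

/-- Split off the vertical part of `X`; the horizontal part contributes nothing and `T_ξ` evaluates
the rest. -/
theorem T_eq {X Y Z : V} (hT : ∀ X Y Z, C.Horizontal X → C.Horizontal Y → C.Horizontal Z →
    C.T X Y Z = 0) (hY : C.Horizontal Y) (hZ : C.Horizontal Z) :
    C.T X Y Z = C.g X C.ξ * C.g (C.φ (C.h Y)) Z := by
  have h := hT (X - C.g X C.ξ • C.ξ) Y Z (by simp [Horizontal, C.g_ξ_ξ]) hY hZ
  rw [T_sub₁, T_smul₁, C.T_swap₁₂ C.ξ, C.T_swap₂₃ Y, T_ξ] at h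
  linear_combination h

/-- The Ricci identity for `φ` on the contact distribution, when `∇φ` is purely vertical there. -/
theorem R_sub_R_φ (hT : ∀ X Y Z, C.Horizontal X → C.Horizontal Y → C.Horizontal Z →
    C.T X Y Z = 0) {X W : V} (hX : C.Horizontal X) (hW : C.Horizontal W) :
    C.R W X X W - C.R W X (C.φ X) (C.φ W) =
      C.g X (C.h W) ^ 2 + C.g X (C.φ (C.h W)) ^ 2 := by
  have hξ : ∀ X Y, C.Horizontal X → C.g (C.nabla Y X) C.ξ = -C.g X (C.h Y) := fun X Y hX => by
    have := C.d_g Y X C.ξ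
    rw [hX, C.d_zero] at this
    rw [h]
    linear_combination -this
  -- As `T` vanishes on horizontal triples, only the vertical parts of the differentiated arguments
  -- contribute to `∇T`; by `hξ` that of `∇_W X` is `-g(X, hW)ξ`.
  have hS : ∀ W X Y Z, C.Horizontal X → C.Horizontal Y → C.Horizontal Z → C.S W X Y Z =
      C.g X (C.h W) * C.g (C.φ (C.h Y)) Z + C.g Y (C.h W) * C.g (C.φ (C.h Z)) X
        + C.g Z (C.h W) * C.g (C.φ (C.h X)) Y := fun W X Y Z hX hY hZ => by
    rw [S, hT X Y Z hX hY hZ, C.d_zero, T_eq hT hY hZ, C.T_swap₁₂ X, C.T_swap₂₃ _ X, neg_neg,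
      T_eq hT hZ hX, C.T_swap₁₃ X, C.T_swap₂₃ _ Y, neg_neg, T_eq hT hX hY, hξ X W hX, hξ Y W hY,
      hξ Z W hZ]
    ring
  have key := C.R_φ W X X (C.φ W)
  have hφW := C.horizontal_φ W
  rw [hS W X X _ hX hX hφW, hS X W X _ hW hX hφW, hW.φ_φ, h_φ, map_neg,
    (C.horizontal_h W).φ_φ] at key
  have e₁ : C.R W X X (-W) = -C.R W X X W := by simp only [R, map_neg]
  have e₂ : C.g (C.φ (C.h X)) (C.φ W) = -C.g X (C.h W) := by
    rw [C.g_φ, hW.φ_φ, map_neg, neg_neg, C.g_h]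
  have e₃ : C.g (C.φ W) (C.h X) = C.g X (C.φ (C.h W)) := by
    rw [C.g_symm, C.g_h, h_φ, map_neg, neg_neg]
  have e₄ : C.g (C.φ (C.h W)) X = C.g X (C.φ (C.h W)) := C.g_symm _ _
  have e₅ : C.g W (C.h X) = -C.g X (C.h W) := by rw [C.g_symm, C.g_h]
  have e₆ : C.g (C.φ W) (C.h W) = 0 := by
    have : C.g (C.φ W) (C.h W) = -C.g (C.φ W) (C.h W) := by
      conv_lhs => rw [C.g_symm, C.g_h, h_φ, map_neg, neg_neg, C.g_symm, C.g_φ, C.g_symm]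
    exact eq_zero_of_two_mul (by linear_combination this)
  have e₇ : C.g X (C.h X) = 0 := by
    have : C.g X (C.h X) = -C.g X (C.h X) := by conv_lhs => rw [C.g_symm, C.g_h]
    exact eq_zero_of_two_mul (by linear_combination this)
  have e₈ : C.g (- -C.h W) X = C.g X (C.h W) := by rw [neg_neg, C.g_symm]
  rw [e₁, e₂, e₃, e₄, e₅, e₆, e₇, e₈] at key
  linear_combination -key

end NearlyCosymplecticCalculus

/-! ### Polarisation of sectional curvature -/

/-- A curvature-like function whose sectional curvatures vanish is zero. -/
theorem eq_zero_of_sectional_eq_zero {G : Type*} [AddCommGroup G] {P : G → Prop}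
    (hP : ∀ x y, P x → P y → P (x + y)) {B : G → G → G → G → ℝ}
    (add : ∀ x x' y z w, B (x + x') y z w = B x y z w + B x' y z w)
    (s₁₂ : ∀ x y z w, B x y z w = -B y x z w) (s₃₄ : ∀ x y z w, B x y z w = -B x y w z)
    (pair : ∀ x y z w, B x y z w = B z w x y)
    (bianchi : ∀ x y z w, B x y z w + B y z x w + B z x y w = 0)
    (sec : ∀ x y, P x → P y → B x y y x = 0) {x y z w : G} (hx : P x) (hy : P y) (hz : P z)
    (hw : P w) : B x y z w = 0 := by
  have add₂ : ∀ x y y' z w, B x (y + y') z w = B x y z w + B x y' z w := fun x y y' z w => by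
    rw [s₁₂, add, s₁₂ x y, s₁₂ x y']; ring
  have add₃ : ∀ x y z z' w, B x y (z + z') w = B x y z w + B x y z' w := fun x y z z' w => by
    rw [pair, add, pair z, pair z']
  have add₄ : ∀ x y z w w', B x y z (w + w') = B x y z w + B x y z w' := fun x y z w w' => by
    rw [s₃₄, add₃, s₃₄ x y z w, s₃₄ x y z w']; ring
  -- Polarising in the outer pair and then in the inner pair makes `B` skew in its middle arguments,
  -- and the Bianchi identity then gives `3B = 0`.
  have h₁ : ∀ x y z, P x → P y → P z → B x y y z = 0 := fun x y z hx hy hz => by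
    have h := sec (x + z) y (hP _ _ hx hz) hy
    rw [add, add₄, add₄, sec x y hx hy, sec z y hz hy, pair z, s₁₂ y x, s₃₄ x y z] at h
    linarith
  have h₂ : ∀ x y z w, P x → P y → P z → P w → B x y z w = -B x z y w :=
    fun x y z w hx hy hz hw => by
    have h := h₁ x (y + z) w hx (hP _ _ hy hz) hw
    rw [add₂, add₃, add₃, h₁ x y w hx hy hw, h₁ x z w hx hz hw] at h
    linarith
  have b := bianchi x y z w
  have e₁ := h₂ x y z w hx hy hz hw
  have e₂ := h₂ y x z w hy hx hz hw
  rw [s₁₂ z x] at b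
  rw [s₁₂ y x] at e₂
  linarith

/-! ### Linear algebra -/

section LinearAlgebra

variable {V : Type*} [AddCommGroup V] [Module ℝ V]

theorem Fin.eq_zero_or_odd_or_even {n : ℕ} (j : Fin (2 * n + 1)) :
    j = 0 ∨ (∃ i : Fin n, j = ⟨2 * i + 1, by omega⟩) ∨ ∃ i : Fin n, j = ⟨2 * i + 2, by omega⟩ := by
  obtain ⟨j, hj⟩ := j
  rcases Nat.eq_zero_or_pos j with rfl | h0
  · exact Or.inl rfl
  · refine Or.inr ?_
    rcases Nat.even_or_odd' j with ⟨k, rfl | rfl⟩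
    · exact Or.inr ⟨⟨k - 1, by omega⟩, Fin.ext (by simp only; omega)⟩
    · exact Or.inl ⟨⟨k, by omega⟩, rfl⟩

/-- The product `α ⊗ θ ⊗ ⋯ ⊗ θ` as a function of `2n+1` vectors. -/
def formProd (n : ℕ) (α : V →ₗ[ℝ] ℝ) (θ : V →ₗ[ℝ] V →ₗ[ℝ] ℝ) (v : Fin (2 * n + 1) → V) : ℝ :=
  α (v 0) * ∏ i : Fin n, θ (v ⟨2 * i + 1, by omega⟩) (v ⟨2 * i + 2, by omega⟩)

/-- Each slot occurs in exactly one factor. One linear functional per slot serves both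
multilinearity and the vanishing on a common null vector. -/
theorem exists_formProd_update (n : ℕ) (α : V →ₗ[ℝ] ℝ) (θ : V →ₗ[ℝ] V →ₗ[ℝ] ℝ)
    (v : Fin (2 * n + 1) → V) (j : Fin (2 * n + 1)) :
    ∃ L : V →ₗ[ℝ] ℝ, (∀ x, formProd n α θ (Function.update v j x) = L x) ∧
      ∀ u, α u = 0 → θ u = 0 → (∀ w, θ w u = 0) → L u = 0 := by
  rcases Fin.eq_zero_or_odd_or_even j with rfl | ⟨i, rfl⟩ | ⟨i, rfl⟩
  · refine ⟨(∏ i : Fin n, θ (v ⟨2 * i + 1, by omega⟩) (v ⟨2 * i + 2, by omega⟩)) • α, fun x => ?_,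
      fun u h _ _ => by simp [h]⟩
    simp only [formProd, Function.update_self, LinearMap.smul_apply, smul_eq_mul]
    rw [mul_comm]
    congr 1
  · refine ⟨(α (v 0) * ∏ k ∈ Finset.univ.erase i, θ (v ⟨2 * k + 1, by omega⟩)
      (v ⟨2 * k + 2, by omega⟩)) • θ.flip (v ⟨2 * i + 2, by omega⟩), fun x => ?_,
      fun u _ h _ => by simp [h]⟩
    simp only [formProd, LinearMap.smul_apply, smul_eq_mul, LinearMap.flip_apply]
    rw [← Finset.mul_prod_erase _ _ (Finset.mem_univ i), Function.update_self,
      Function.update_of_ne (by simp [Fin.ext_iff]), Function.update_of_ne (by simp [Fin.ext_iff]),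
      mul_assoc, mul_comm (θ x _)]
    congr 2
    refine Finset.prod_congr rfl fun k hk => ?_
    have := Fin.val_ne_of_ne (Finset.ne_of_mem_erase hk)
    rw [Function.update_of_ne, Function.update_of_ne] <;> simp only [ne_eq, Fin.mk.injEq] <;> omega
  · refine ⟨(α (v 0) * ∏ k ∈ Finset.univ.erase i, θ (v ⟨2 * k + 1, by omega⟩)
      (v ⟨2 * k + 2, by omega⟩)) • θ (v ⟨2 * i + 1, by omega⟩), fun x => ?_,
      fun u _ _ h => by simp [h]⟩
    simp only [formProd, LinearMap.smul_apply, smul_eq_mul]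
    rw [← Finset.mul_prod_erase _ _ (Finset.mem_univ i), Function.update_self,
      Function.update_of_ne (by simp [Fin.ext_iff]), Function.update_of_ne (by simp [Fin.ext_iff]),
      mul_assoc, mul_comm (θ _ x)]
    congr 2
    refine Finset.prod_congr rfl fun k hk => ?_
    have := Fin.val_ne_of_ne (Finset.ne_of_mem_erase hk)
    rw [Function.update_of_ne, Function.update_of_ne] <;> simp only [ne_eq, Fin.mk.injEq] <;> omega

/-- `formProd` as a multilinear map. -/
def formProdMultilinear (n : ℕ) (α : V →ₗ[ℝ] ℝ) (θ : V →ₗ[ℝ] V →ₗ[ℝ] ℝ) :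
    MultilinearMap ℝ (fun _ : Fin (2 * n + 1) => V) ℝ where
  toFun := formProd n α θ
  map_update_add' {inst} v j x y := by
    obtain rfl : inst = instDecidableEqFin _ := Subsingleton.elim _ _
    obtain ⟨L, hL, -⟩ := exists_formProd_update n α θ v j
    rw [hL, hL, hL, map_add]
  map_update_smul' {inst} v j a x := by
    obtain rfl : inst = instDecidableEqFin _ := Subsingleton.elim _ _
    obtain ⟨L, hL, -⟩ := exists_formProd_update n α θ v j
    rw [hL, hL, map_smul]

theorem AlternatingMap.eq_zero_of_contraction_eq_zero {ι : Type*} [Fintype ι] [DecidableEq ι]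
    [Module.Finite ℝ V] (hι : Fintype.card ι = Module.finrank ℝ V) (f : V [⋀^ι]→ₗ[ℝ] ℝ) {u : V}
    (hu : u ≠ 0) (hf : ∀ v j, f (Function.update v j u) = 0) : f = 0 := by
  ext v
  by_contra hv
  have hli : LinearIndependent ℝ v := by
    by_contra h
    exact hv (f.map_linearDependent v h)
  let b := basisOfLinearIndependentOfCardEqFinrank' v hli hι
  have hb : ∀ i, b i = v i := fun i => by simp [b]
  obtain ⟨j, hj⟩ : ∃ j, b.repr u j ≠ 0 := by
    by_contra! h
    exact hu (b.repr.map_eq_zero_iff.1 (Finsupp.ext h))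
  -- Expand `u` in the basis `v`: every term but the `j`-th repeats an entry, so `f` of the updated
  -- family is the nonzero `j`-th coefficient times `f v`.
  have h := hf v j
  rw [← b.sum_repr u, f.map_update_sum, Finset.sum_eq_single j] at h
  · rw [f.map_update_smul, hb, Function.update_eq_self, smul_eq_mul] at h
    exact (mul_ne_zero hj hv) h
  · intro i _ hij
    rw [f.map_update_smul, hb, f.map_update_self v hij.symm, smul_zero]
  · simp

/-- If `α` and `θ` have a common null vector then `α ∧ θ^n = 0` in dimension `2n+1`. -/
theorem sum_formProd_eq_zero [Module.Finite ℝ V] {n : ℕ} (hV : Module.finrank ℝ V = 2 * n + 1)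
    (α : V →ₗ[ℝ] ℝ) (θ : V →ₗ[ℝ] V →ₗ[ℝ] ℝ) {u : V} (hu : u ≠ 0) (hα : α u = 0) (hθ : θ u = 0)
    (hθ' : ∀ w, θ w u = 0) (v : Fin (2 * n + 1) → V) :
    ∑ σ : Equiv.Perm (Fin (2 * n + 1)),
      ((Equiv.Perm.sign σ : ℤ) : ℝ) * formProd n α θ (fun i => v (σ i)) = 0 := by
  have hm : ∀ v j, v j = u → formProd n α θ v = 0 := fun v j h => by
    obtain ⟨L, hL, hL₀⟩ := exists_formProd_update n α θ v j
    rw [← Function.update_eq_self j v, hL, h, hL₀ u hα hθ hθ']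
  have key : ∀ v, (formProdMultilinear n α θ).alternatization v =
      ∑ σ : Equiv.Perm (Fin (2 * n + 1)),
        ((Equiv.Perm.sign σ : ℤ) : ℝ) * formProd n α θ (fun i => v (σ i)) := fun v => by
    rw [MultilinearMap.alternatization_apply]
    refine Finset.sum_congr rfl fun σ _ => ?_
    rw [← zsmul_eq_mul]
    rfl
  have h₀ : (formProdMultilinear n α θ).alternatization = 0 :=
    AlternatingMap.eq_zero_of_contraction_eq_zero (by simp [hV]) _ hu fun v j => by
      rw [key]
      refine Finset.sum_eq_zero fun σ _ => ?_
      rw [hm _ (σ.symm j) (by simp), mul_zero]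
  rw [← key, h₀, AlternatingMap.zero_apply]

end LinearAlgebra

/-! ### The pointwise dimension argument -/

/-- An algebraic constraint on the dimension. -/
theorem finrank_eq_five_of_curvature_identity {V : Type*} [NormedAddCommGroup V]
    [InnerProductSpace ℝ V] [FiniteDimensional ℝ V] (φ h : V →ₗ[ℝ] V) {ξ : V} {c : ℝ}
    (hV : 1 < Module.finrank ℝ V) (hξ : inner ℝ ξ ξ = (1 : ℝ)) (φ_ξ : φ ξ = 0) (h_ξ : h ξ = 0)
    (inner_φ : ∀ u v, (inner ℝ (φ u) v : ℝ) = -inner ℝ u (φ v))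
    (inner_h : ∀ u v, (inner ℝ (h u) v : ℝ) = -inner ℝ u (h v))
    (h_φ : ∀ u, h (φ u) = -φ (h u))
    (φ_φ : ∀ u, inner ℝ u ξ = (0 : ℝ) → φ (φ u) = -u)
    (h_inj : ∀ u, inner ℝ u ξ = (0 : ℝ) → h u = 0 → u = 0)
    (hc : ∀ x w : V, inner ℝ x ξ = (0 : ℝ) → inner ℝ w ξ = (0 : ℝ) →
      c * (inner ℝ x x * inner ℝ w w - inner ℝ x w ^ 2 - inner ℝ x (φ w) ^ 2) =
        inner ℝ x (h w) ^ 2 + inner ℝ x (φ (h w)) ^ 2) :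
    c ≠ 0 ∧ Module.finrank ℝ V = 5 := by
  obtain ⟨w, hwξ, hw⟩ : ∃ w : V, inner ℝ w ξ = (0 : ℝ) ∧ w ≠ 0 := by
    by_contra! H
    refine hV.not_ge (finrank_le_one ξ fun v => ⟨inner ℝ v ξ, ?_⟩)
    have := H (v - (inner ℝ v ξ : ℝ) • ξ) (by
      rw [inner_sub_left, real_inner_smul_left, hξ, mul_one, sub_self])
    exact (sub_eq_zero.1 this).symm
  have φξ : ∀ u, inner ℝ (φ u) ξ = (0 : ℝ) := fun u => by
    rw [inner_φ, φ_ξ, inner_zero_right, neg_zero]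
  have hhξ : ∀ u, inner ℝ (h u) ξ = (0 : ℝ) := fun u => by
    rw [inner_h, h_ξ, inner_zero_right, neg_zero]
  have φ_self : ∀ u, inner ℝ u (φ u) = (0 : ℝ) := fun u => by
    have := inner_φ u u
    rw [real_inner_comm] at this
    linarith
  have h_self : ∀ u, inner ℝ u (h u) = (0 : ℝ) := fun u => by
    have := inner_h u u
    rw [real_inner_comm] at this
    linarith
  have φh_self : ∀ u, inner ℝ u (φ (h u)) = (0 : ℝ) := fun u => by
    have := inner_φ u (h u)
    rw [real_inner_comm, ← neg_neg (φ (h u)), ← h_φ, inner_neg_right, ← inner_h,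
      real_inner_comm] at this
    rw [inner_φ] at this
    linarith
  have φ_ne : ∀ u, inner ℝ u ξ = (0 : ℝ) → u ≠ 0 → φ u ≠ 0 := fun u hu hu0 e => by
    have := φ_φ u hu
    rw [e, map_zero, eq_comm, neg_eq_zero] at this
    exact hu0 this
  have hw0 : h w ≠ 0 := fun e => hw (h_inj w hwξ e)
  have c_ne : c ≠ 0 := by
    rintro rfl
    -- For `c = 0` and `x = hw` the right side is `|hw|⁴`, since `hw` is orthogonal to `φhw`.
    have := hc (h w) w (hhξ w) hwξ
    rw [zero_mul, φ_self, sq (0 : ℝ), mul_zero, add_zero, eq_comm, sq_eq_zero_iff] at this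
    exact hw0 (inner_self_eq_zero.1 this)
  refine ⟨c_ne, ?_⟩
  have φwhw : inner ℝ (φ w) (h w) = (0 : ℝ) := by rw [inner_φ, φh_self, neg_zero]
  have φwφhw : inner ℝ (φ w) (φ (h w)) = (0 : ℝ) := by
    rw [inner_φ, φ_φ _ (hhξ w), inner_neg_right, h_self, neg_zero, neg_zero]
  let e : Fin 5 → V := ![ξ, w, φ w, h w, φ (h w)]
  have he0 : ∀ i, e i ≠ 0 := by
    have hξ0 : ξ ≠ 0 := fun e => by rw [e, inner_zero_right] at hξ; exact zero_ne_one hξ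
    intro i
    fin_cases i
    exacts [hξ0, hw, φ_ne w hwξ hw, hw0, φ_ne _ (hhξ w) hw0]
  have lt : ∀ i j, i < j → inner ℝ (e j) (e i) = (0 : ℝ) := by
    intro i j hij
    fin_cases i <;> fin_cases j <;> first | exact absurd hij (by decide) | skip
    · exact hwξ
    · exact φξ w
    · exact hhξ w
    · exact φξ _
    · exact (real_inner_comm _ _).trans (φ_self w)
    · exact (real_inner_comm _ _).trans (h_self w)
    · exact (real_inner_comm _ _).trans (φh_self w)
    · exact (real_inner_comm _ _).trans φwhw
    · exact (real_inner_comm _ _).trans φwφhw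
    · exact (real_inner_comm _ _).trans (φ_self _)
  have hli : LinearIndependent ℝ e := linearIndependent_of_ne_zero_of_inner_eq_zero he0
    fun i j hij => by
      rcases lt_or_gt_of_ne hij with h | h
      · rw [real_inner_comm, lt i j h]
      · exact lt j i h
  have hspan : Submodule.span ℝ (Set.range e) = ⊤ := by
    rw [← Submodule.orthogonal_eq_bot_iff, Submodule.eq_bot_iff]
    intro x hx
    have hx' : ∀ i, inner ℝ x (e i) = (0 : ℝ) := fun i =>
      Submodule.inner_left_of_mem_orthogonal (Submodule.subset_span (Set.mem_range_self i)) hx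
    have h₀ : inner ℝ x ξ = (0 : ℝ) := hx' 0
    have h₁ : inner ℝ x w = (0 : ℝ) := hx' 1
    have h₂ : inner ℝ x (φ w) = (0 : ℝ) := hx' 2
    have h₃ : inner ℝ x (h w) = (0 : ℝ) := hx' 3
    have h₄ : inner ℝ x (φ (h w)) = (0 : ℝ) := hx' 4
    -- Orthogonality to the five vectors removes every square from the identity.
    have := hc x w h₀ hwξ
    rw [h₁, h₂, h₃, h₄] at this
    have : inner ℝ x x * inner ℝ w w = (0 : ℝ) :=
      mul_left_cancel₀ c_ne (by linear_combination this)
    exact inner_self_eq_zero.1 ((mul_eq_zero.1 this).resolve_right (inner_self_ne_zero.2 hw))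
  have := finrank_span_eq_card hli
  rwa [hspan, finrank_top, Fintype.card_fin] at this

/-! ### Smooth vector fields as a Riemannian calculus -/

noncomputable section

namespace RiemGeom

variable {E : Type*} [NormedAddCommGroup E] [NormedSpace ℝ E] [FiniteDimensional ℝ E]
  {H : Type*} [TopologicalSpace H] {I : ModelWithCorners ℝ E H}
  {M : Type*} [TopologicalSpace M] [ChartedSpace H M] [IsManifold I ∞ M]
  [RiemannianBundle (fun x : M => TangentSpace I x)]
  [IsContMDiffRiemannianBundle I ∞ E (fun x : M => TangentSpace I x)]

open scoped Topology
open Filter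

theorem contMDiff_mvfderiv_apply {X : Π x : M, TangentSpace I x} {f : M → ℝ}
    (hX : CMDiff ∞ (T% X)) (hf : CMDiff ∞ f) : CMDiff ∞ (fun x => d% f x (X x)) := by
  have h : CMDiff ∞ (fun x => tangentMap I 𝓘(ℝ, ℝ) f (T% X x)) :=
    (hf.contMDiff_tangentMap (m := ∞) le_rfl).comp hX
  exact (contMDiff_snd_tangentBundle_modelSpace ℝ 𝓘(ℝ, ℝ)).comp h

theorem contMDiff_mlieBracket {X Y : Π x : M, TangentSpace I x}
    (hX : CMDiff ∞ (T% X)) (hY : CMDiff ∞ (T% Y)) : CMDiff ∞ (T% (mlieBracket I X Y)) :=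
  haveI : IsManifold I (minSmoothness ℝ 2) M := IsManifold.of_le (n := ∞) (by
    rw [minSmoothness_of_isRCLikeNormedField]; exact ENat.LEInfty.out)
  haveI : IsManifold I (((⊤ : ℕ∞) : WithTop ℕ∞) + 1) M := IsManifold.of_le (n := ∞) le_rfl
  fun x => ContMDiffAt.mlieBracket_vectorField (m := ⊤) (n := ⊤) (hX x) (hY x) (by simp)

theorem contMDiff_inner {X Y : Π x : M, TangentSpace I x}
    (hX : CMDiff ∞ (T% X)) (hY : CMDiff ∞ (T% Y)) :
    CMDiff ∞ (fun x => (inner ℝ (X x) (Y x) : ℝ)) :=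
  ContMDiff.inner_bundle (E := fun x : M => TangentSpace I x) hX hY

theorem contMDiff_koszul {X Y Z : Π x : M, TangentSpace I x}
    (hX : CMDiff ∞ (T% X)) (hY : CMDiff ∞ (T% Y)) (hZ : CMDiff ∞ (T% Z)) :
    CMDiff ∞ (fun x => koszul Y X Z x) := by
  have hi := @contMDiff_inner _ _ _ _ _ _ I M _ _ _ _ _
  have hb := @contMDiff_mlieBracket _ _ _ _ _ _ I M _ _ _
  exact contMDiff_const.mul ((((((contMDiff_mvfderiv_apply hX (hi hY hZ)).add
    (contMDiff_mvfderiv_apply hY (hi hX hZ))).sub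
    (contMDiff_mvfderiv_apply hZ (hi hX hY))).add (hi (hb hX hY) hZ)).sub
    (hi (hb hX hZ) hY)).sub (hi (hb hY hZ) hX))

/-- A tangent vector extends to a global smooth vector field, equal near the base point to the
standard local extension. -/
theorem exists_contMDiff_eventuallyEq_extend [T2Space M] {x : M} (v : TangentSpace I x) :
    ∃ X : Π y : M, TangentSpace I y, CMDiff ∞ (T% X) ∧
      ∀ᶠ y in 𝓝 x, X y = (extend E v : Π y : M, TangentSpace I y) y := by
  obtain ⟨s, hs, hsm⟩ :=
    exists_contMDiffOn_extend (k := ∞) I E (V := fun x : M => TangentSpace I x) v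
  obtain ⟨t, hts, ht, hxt⟩ := mem_nhds_iff.1 hs
  obtain ⟨f, -, hf⟩ := (SmoothBumpFunction.nhds_basis_tsupport (I := I) (c := x)).mem_iff.1
    (ht.mem_nhds hxt)
  -- Multiply by a bump function supported where the local extension is smooth; it equals 1 near
  -- `x`.
  refine ⟨(f : M → ℝ) • (extend E v : Π y : M, TangentSpace I y),
    (f.contMDiff.contMDiffOn).smul_section_of_tsupport ht hf (hsm.mono hts), ?_⟩
  filter_upwards [f.eventuallyEq_one] with y hy
  simp [hy]

theorem contMDiffAt_det {ι : Type*} [Fintype ι] [DecidableEq ι] {A : M → Matrix ι ι ℝ} {x : M}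
    (hA : ∀ i j, CMDiffAt ∞ (fun y => A y i j) x) : CMDiffAt ∞ (fun y => (A y).det) x := by
  simp only [Matrix.det_apply']
  exact ContMDiffAt.sum fun σ _ => contMDiffAt_const.mul (ContMDiffAt.prod fun i _ => hA _ _)

/-- A vector field is smooth if its inner products with smooth vector fields are smooth. -/
theorem contMDiffAt_of_inner [T2Space M] {X : Π y : M, TangentSpace I y} {x : M}
    (h : ∀ Z : Π y : M, TangentSpace I y, CMDiff ∞ (T% Z) →
      CMDiffAt ∞ (fun y => (inner ℝ (X y) (Z y) : ℝ)) x) : CMDiffAt ∞ (T% X) x := by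
  classical
  let b := Module.finBasis ℝ (TangentSpace I x)
  choose S hS hSb using fun i => exists_contMDiff_eventuallyEq_extend (I := I) (b i)
  let A : M → Matrix _ _ ℝ := fun y => Matrix.gram ℝ (fun i => S i y)
  have hA : ∀ i j, CMDiffAt ∞ (fun y => A y i j) x := fun i j =>
    contMDiff_inner (hS i) (hS j) x
  have hdet := contMDiffAt_det hA
  have hx : (A x).det ≠ 0 := by
    rw [Matrix.det_gram_ne_zero_iff_linearIndependent]
    have : (fun i => S i x) = b := by
      ext i
      rw [(hSb i).self_of_nhds, extend_apply_self]
    rw [this]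
    exact b.linearIndependent
  -- Cramer's rule for the Gram matrix of the local frame `S`: up to the factor `det`, these are the
  -- coefficients of `X`, and they are polynomial in smooth inner products.
  let c : M → _ → ℝ := fun y => (A y).cramer fun j => (inner ℝ (X y) (S j y) : ℝ)
  have hc : ∀ i, CMDiffAt ∞ (fun y => c y i) x := fun i => by
    simp only [c, Matrix.cramer_apply]
    refine contMDiffAt_det fun k l => ?_
    simp only [Matrix.updateCol_apply]
    split_ifs
    · exact h _ (hS k)
    · exact hA k l
  have hX : CMDiffAt ∞ (T% (fun y => ∑ i, ((A y).det)⁻¹ • c y i • S i y)) x :=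
    ContMDiffAt.sum_section fun i _ =>
      (hdet.inv₀ hx).smul_section ((hc i).smul_section (hS i x))
  refine hX.congr_of_eventuallyEq ?_
  filter_upwards [hdet.continuousAt.eventually_ne hx] with y hy
  have hli := (Matrix.det_gram_ne_zero_iff_linearIndependent (𝕜 := ℝ)).1 hy
  have hsp := hli.span_eq_top_of_card_eq_finrank' (by
    rw [Fintype.card_fin]; rfl)
  congr 1
  refine ext_inner_right ℝ fun w => ?_
  have hw : w ∈ Submodule.span ℝ (Set.range fun i => S i y) := hsp ▸ Submodule.mem_top
  induction hw using Submodule.span_induction with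
  | mem w hw =>
    obtain ⟨j, rfl⟩ := hw
    have e := congrFun (Matrix.mulVec_cramer (A y) fun j => (inner ℝ (X y) (S j y) : ℝ)) j
    simp only [Matrix.mulVec, dotProduct, Pi.smul_apply, smul_eq_mul] at e
    simp only [sum_inner, inner_smul_left, conj_trivial]
    rw [← Finset.mul_sum, eq_inv_mul_iff_mul_eq₀ hy, ← e]
    refine Finset.sum_congr rfl fun i _ => ?_
    rw [mul_comm, real_inner_comm]
    rfl
  | zero => simp
  | add u v _ _ hu hv => rw [inner_add_right, inner_add_right, hu, hv]
  | smul a u _ hu => rw [inner_smul_right, inner_smul_right, hu]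

theorem contMDiff_leviCivita [T2Space M] {X Y : Π x : M, TangentSpace I x}
    (hX : CMDiff ∞ (T% X)) (hY : CMDiff ∞ (T% Y)) :
    CMDiff ∞ (T% (fun x => leviCivita Y x (X x))) := fun x =>
  contMDiffAt_of_inner fun Z hZ => by
    have : (fun y => (inner ℝ (leviCivita Y y (X y)) (Z y) : ℝ)) = fun y => koszul Y X Z y := by
      ext y
      exact inner_leviCivitaFun ((hX y).mdifferentiableAt (by simp))
        ((hY y).mdifferentiableAt (by simp)) ((hZ y).mdifferentiableAt (by simp))
    rw [this]
    exact contMDiff_koszul hX hY hZ x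

variable (I M) in
/-- Smooth vector fields. -/
abbrev SmoothField := ContMDiffSection I E ∞ (fun x : M => TangentSpace I x)

variable (I M) in
/-- Smooth functions. -/
abbrev SmoothFun := ContMDiffMap I 𝓘(ℝ, ℝ) M ℝ ∞

instance : SMul (SmoothFun I M) (SmoothField I M) where
  smul f X := ⟨(f : M → ℝ) • (X : Π x : M, TangentSpace I x), f.contMDiff.smul_section X.contMDiff⟩

instance : Module (SmoothFun I M) (SmoothField I M) where
  one_smul X := by ext x; exact one_smul ℝ (X x)
  mul_smul f h X := by ext x; exact mul_smul (f x) (h x) (X x)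
  smul_zero f := by ext x; exact smul_zero (f x)
  smul_add f X Y := by ext x; exact smul_add (f x) (X x) (Y x)
  add_smul f h X := by ext x; exact add_smul (f x) (h x) (X x)
  zero_smul X := by ext x; exact zero_smul ℝ (X x)

instance : IsAddTorsionFree (SmoothFun I M) where
  nsmul_right_injective n hn f h e := by
    ext x
    have : n • f x = n • h x := congrArg (fun f : SmoothFun I M => f x) e
    simpa [Nat.cast_ne_zero.2 hn] using this

theorem SmoothField.mdifferentiableAt (X : SmoothField I M) (x : M) :
    MDiffAt (T% (X : Π x : M, TangentSpace I x)) x :=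
  (X.contMDiff x).mdifferentiableAt (by simp)

theorem SmoothFun.mdifferentiableAt (f : SmoothFun I M) (x : M) : MDiffAt (f : M → ℝ) x :=
  (f.contMDiff x).mdifferentiableAt (by simp)

variable (I M) in
/-- The metric on smooth vector fields. -/
def smoothMetric : SmoothField I M →ₗ[SmoothFun I M] SmoothField I M →ₗ[SmoothFun I M]
    SmoothFun I M :=
  LinearMap.mk₂ _
    (fun X Y => ⟨fun x => inner ℝ (X x) (Y x), contMDiff_inner X.contMDiff Y.contMDiff⟩)
    (fun X X' Y => by ext x; exact inner_add_left (X x) (X' x) (Y x))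
    (fun f X Y => by ext x; exact real_inner_smul_left (X x) (Y x) (f x))
    (fun X Y Y' => by ext x; exact inner_add_right (X x) (Y x) (Y' x))
    (fun f X Y => by ext x; exact real_inner_smul_right (X x) (Y x) (f x))

/-- `∇_X Y` for smooth vector fields. -/
def smoothNabla [T2Space M] (X Y : SmoothField I M) : SmoothField I M :=
  ⟨fun x => leviCivita (Y : Π x : M, TangentSpace I x) x (X x),
    contMDiff_leviCivita X.contMDiff Y.contMDiff⟩

theorem smoothNabla_apply [T2Space M] (X Y : SmoothField I M) (x : M) :
    smoothNabla X Y x = leviCivita (Y : Π x : M, TangentSpace I x) x (X x) := rfl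

theorem smoothNabla_sub_eq_mlieBracket [T2Space M] (X Y : SmoothField I M) :
    (smoothNabla X Y - smoothNabla Y X : SmoothField I M) =
      ⟨mlieBracket I X Y, contMDiff_mlieBracket X.contMDiff Y.contMDiff⟩ := by
  ext x
  exact (CovariantDerivative.torsion_eq_zero_iff _).1 leviCivita_torsion (X.mdifferentiableAt x)
    (Y.mdifferentiableAt x)

/-- The derivative of a smooth function along a smooth vector field. -/
def smoothDeriv (X : SmoothField I M) (f : SmoothFun I M) : SmoothFun I M :=
  ⟨fun x => d% (f : M → ℝ) x (X x), contMDiff_mvfderiv_apply X.contMDiff f.contMDiff⟩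

variable (I M) in
/-- The calculus of smooth vector fields on a Riemannian manifold. -/
def smoothCalculus [T2Space M] : RiemannianCalculus (SmoothFun I M) (SmoothField I M) where
  d := smoothDeriv
  g := smoothMetric I M
  nabla := smoothNabla
  d_add X f h := by
    ext x
    exact congrArg (fun L => L (X x)) (mvfderiv_add (f.mdifferentiableAt x) (h.mdifferentiableAt x))
  d_mul X f h := by
    ext x
    have := congrArg (fun L => L (X x))
      (mvfderiv_mul (f.mdifferentiableAt x) (h.mdifferentiableAt x))
    exact this
  g_symm X Y := by ext x; exact real_inner_comm (Y x) (X x)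
  g_nondegenerate X hX := by
    ext x
    have := congrArg (fun f : SmoothFun I M => f x) (hX X)
    exact inner_self_eq_zero.1 this
  nabla_add_left X X' Y := by
    ext x
    exact map_add (leviCivita (Y : Π x : M, TangentSpace I x) x) (X x) (X' x)
  nabla_smul_left f X Y := by
    ext x
    exact map_smul (leviCivita (Y : Π x : M, TangentSpace I x) x) (f x) (X x)
  nabla_add_right X Y Y' := by
    ext x
    exact congrArg (fun L => L (X x)) (leviCivita.isCovariantDerivativeOnUniv.add
      (Y.mdifferentiableAt x) (Y'.mdifferentiableAt x))
  nabla_smul_right X f Y := by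
    ext x
    exact congrArg (fun L => L (X x)) (leviCivita.isCovariantDerivativeOnUniv.leibniz
      (Y.mdifferentiableAt x) (f.mdifferentiableAt x))
  d_g X Y Z := by
    ext x
    exact leviCivita_metric (X.mdifferentiableAt x) (Y.mdifferentiableAt x) (Z.mdifferentiableAt x)
  jacobi X Y Z := by
    have : IsManifold I (minSmoothness ℝ 3) M := IsManifold.of_le (n := ∞) (by
      rw [minSmoothness_of_isRCLikeNormedField]; exact ENat.LEInfty.out)
    simp only [smoothNabla_sub_eq_mlieBracket]
    ext x
    have h : minSmoothness ℝ 2 ≤ ∞ := by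
      rw [minSmoothness_of_isRCLikeNormedField]; exact ENat.LEInfty.out
    exact leibniz_identity_mlieBracket_apply ((X.contMDiff x).of_le h) ((Y.contMDiff x).of_le h)
      ((Z.contMDiff x).of_le h)

theorem exists_smoothField_eventuallyEq_extend [T2Space M] {x : M} (v : TangentSpace I x) :
    ∃ X : SmoothField I M, (X : Π y : M, TangentSpace I y) =ᶠ[𝓝 x]
      (extend E v : Π y : M, TangentSpace I y) := by
  obtain ⟨X, hX, h⟩ := exists_contMDiff_eventuallyEq_extend v
  exact ⟨⟨X, hX⟩, h⟩

theorem exists_smoothField [T2Space M] {x : M} (v : TangentSpace I x) :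
    ∃ X : SmoothField I M, X x = v := by
  obtain ⟨X, h⟩ := exists_smoothField_eventuallyEq_extend v
  exact ⟨X, by rw [h.eq_of_nhds, extend_apply_self]⟩

theorem mdifferentiableAt_congr_field {X Y : Π x : M, TangentSpace I x} {x : M}
    (h : X =ᶠ[𝓝 x] Y) (hX : MDiffAt (T% X) x) : MDiffAt (T% Y) x :=
  hX.congr_of_eventuallyEq (h.mono fun y hy => by simp [hy])

theorem leviCivita_congr {X Y : Π x : M, TangentSpace I x} {x : M} (h : X =ᶠ[𝓝 x] Y)
    (hX : MDiffAt (T% X) x) : leviCivita X x = leviCivita Y x :=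
  leviCivita.isCovariantDerivativeOnUniv.congr_of_eventuallyEq hX
    (mdifferentiableAt_congr_field h hX) Filter.univ_mem h

/-- Covariant derivatives and brackets depend only on germs, so global smooth fields can replace the
local extensions that define `curvature`. -/
theorem curvatureField_congr [T2Space M] {X Y Z : SmoothField I M}
    {X' Y' Z' : Π x : M, TangentSpace I x} {x : M} (hX : X =ᶠ[𝓝 x] X') (hY : Y =ᶠ[𝓝 x] Y')
    (hZ : Z =ᶠ[𝓝 x] Z') : ((smoothCalculus I M).curv X Y Z) x = curvatureField X' Y' Z' x := by
  have h : ∀ {X : SmoothField I M} {X' : Π x : M, TangentSpace I x}, X =ᶠ[𝓝 x] X' →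
      (smoothNabla X Z : Π x : M, TangentSpace I x) =ᶠ[𝓝 x] fun y => leviCivita Z' y (X' y) :=
    fun hX => by
    filter_upwards [hX, hZ.eventually_nhds] with y hy hZy
    rw [smoothNabla_apply, leviCivita_congr hZy (Z.mdifferentiableAt y), hy]
  have e : (smoothCalculus I M).curv X Y Z = smoothNabla X (smoothNabla Y Z)
      - smoothNabla Y (smoothNabla X Z) - smoothNabla (smoothNabla X Y - smoothNabla Y X) Z := rfl
  rw [e, smoothNabla_sub_eq_mlieBracket]
  change smoothNabla X (smoothNabla Y Z) x - smoothNabla Y (smoothNabla X Z) x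
    - leviCivita (Z : Π x : M, TangentSpace I x) x (mlieBracket I X Y x) = _
  rw [smoothNabla_apply, smoothNabla_apply,
    leviCivita_congr (h hY) (SmoothField.mdifferentiableAt _ x),
    leviCivita_congr (h hX) (SmoothField.mdifferentiableAt _ x),
    leviCivita_congr hZ (Z.mdifferentiableAt x), hX.mlieBracket_vectorField_eq hY, hX.eq_of_nhds,
    hY.eq_of_nhds]
  rfl

/-- The curvature tensor depends only on the values of the vector fields at the point. -/
theorem R_congr [T2Space M] {ξ : SmoothField I M} (hξ : smoothMetric I M ξ ξ = 1)
    {X X' Y Y' Z Z' W W' : SmoothField I M} {x : M} (hX : X x = X' x) (hY : Y x = Y' x)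
    (hZ : Z x = Z' x) (hW : W x = W' x) :
    (smoothCalculus I M).R X Y Z W x = (smoothCalculus I M).R X' Y' Z' W' x := by
  set C := smoothCalculus I M
  have h₄ : ∀ {W W' : SmoothField I M}, W x = W' x → ∀ X Y Z, C.R X Y Z W x = C.R X Y Z W' x :=
    fun {W W'} h X Y Z => by
    change inner ℝ (C.curv X Y Z x) (W x) = inner ℝ (C.curv X Y Z x) (W' x)
    rw [h]
  have h₃ : ∀ {Z Z' : SmoothField I M}, Z x = Z' x → ∀ X Y W, C.R X Y Z W x = C.R X Y Z' W x :=
    fun {Z Z'} h X Y W => by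
    rw [C.R_swap₃₄ hξ X Y Z, C.R_swap₃₄ hξ X Y Z']
    exact congrArg Neg.neg (h₄ h X Y W)
  -- The last slot is visibly pointwise and the third follows by skewness; pair symmetry moves the
  -- first two slots into those positions.
  rw [h₄ hW, h₃ hZ, C.R_pair hξ X, C.R_pair hξ X', h₄ hY, h₃ hX]

theorem R_apply [T2Space M] {ξ : SmoothField I M} (hξ : smoothMetric I M ξ ξ = 1)
    (X Y Z W : SmoothField I M) (x : M) :
    (smoothCalculus I M).R X Y Z W x = inner ℝ (curvature (X x) (Y x) (Z x)) (W x) := by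
  obtain ⟨X', hX⟩ := exists_smoothField_eventuallyEq_extend (X x)
  obtain ⟨Y', hY⟩ := exists_smoothField_eventuallyEq_extend (Y x)
  obtain ⟨Z', hZ⟩ := exists_smoothField_eventuallyEq_extend (Z x)
  rw [R_congr hξ (X' := X') (Y' := Y') (Z' := Z') (W' := W) (by simp [hX.eq_of_nhds])
    (by simp [hY.eq_of_nhds]) (by simp [hZ.eq_of_nhds]) rfl]
  change inner ℝ ((smoothCalculus I M).curv X' Y' Z' x) (W x) = _
  rw [curvatureField_congr hX hY hZ, curvature]

/-! ### Almost contact metric structures -/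

section AlmostContact

variable {φ : Π x : M, TangentSpace I x →L[ℝ] TangentSpace I x} {ξ : Π x : M, TangentSpace I x}
  {η : Π x : M, TangentSpace I x →L[ℝ] ℝ}

theorem IsAlmostContactMetric.φ_ξ (h : IsAlmostContactMetric φ ξ η) (x : M) :
    φ x (ξ x) = 0 := by
  have h₁ := h.φ_sq x (ξ x)
  rw [h.η_ξ, one_smul, neg_add_cancel] at h₁
  have h₂ := h.φ_sq x (φ x (ξ x))
  rw [h₁, map_zero] at h₂
  -- Here `φξ = η(φξ)ξ` and `φ²ξ = 0`; applying `φ` once more gives `η(φξ) φξ = 0`.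
  have h₃ := congrArg (φ x) h₂
  have h₄ : η x (φ x (ξ x)) • φ x (ξ x) = 0 := by simpa [h₁] using h₃.symm
  rcases smul_eq_zero.1 h₄ with h₅ | h₅
  · rw [h₅, zero_smul, add_zero] at h₂
    simpa using h₂.symm
  · exact h₅

theorem IsAlmostContactMetric.η_eq (h : IsAlmostContactMetric φ ξ η) (x : M)
    (v : TangentSpace I x) : η x v = inner ℝ v (ξ x) := by
  have := h.metric x v (ξ x)
  rw [h.φ_ξ, inner_zero_right, h.η_ξ] at this
  linarith

/-- Computing `φ³v` in two ways gives `η(φv)ξ = 0`. -/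
theorem IsAlmostContactMetric.η_φ (h : IsAlmostContactMetric φ ξ η) (x : M)
    (v : TangentSpace I x) : η x (φ x v) = 0 := by
  have h₁ := h.φ_sq x (φ x v)
  rw [h.φ_sq x v, map_add, map_neg, map_smul, h.φ_ξ, smul_zero, add_zero, left_eq_add] at h₁
  rcases smul_eq_zero.1 h₁ with h₂ | h₂
  · exact h₂
  · have := h.η_ξ x
    rw [h₂, map_zero] at this
    exact absurd this zero_ne_one

theorem IsAlmostContactMetric.inner_φ (h : IsAlmostContactMetric φ ξ η) (x : M)
    (u v : TangentSpace I x) : (inner ℝ (φ x u) v : ℝ) = -inner ℝ u (φ x v) := by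
  have h₁ := h.metric x u (φ x v)
  rw [h.φ_sq, h.η_φ, mul_zero, sub_zero, inner_add_right, inner_neg_right, inner_smul_right,
    ← h.η_eq, h.η_φ, mul_zero, add_zero] at h₁
  linarith

/-- The calculus of a nearly cosymplectic manifold. -/
def IsNearlyCosymplectic.calculus [T2Space M] (h : IsNearlyCosymplectic φ ξ η) :
    NearlyCosymplecticCalculus (SmoothFun I M) (SmoothField I M) where
  toRiemannianCalculus := smoothCalculus I M
  φ :=
    { toFun X := ⟨fun x => φ x (X x), ContMDiff.clm_bundle_apply
        (E₁ := fun x : M => TangentSpace I x) (E₂ := fun x : M => TangentSpace I x)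
        h.smooth_φ X.contMDiff⟩
      map_add' X Y := by ext x; exact map_add (φ x) (X x) (Y x)
      map_smul' f X := by ext x; exact map_smul (φ x) (f x) (X x) }
  ξ := ⟨ξ, h.smooth_ξ⟩
  g_ξ_ξ := by
    ext x
    exact (h.η_eq x (ξ x)).symm.trans (h.η_ξ x)
  φ_φ X := by
    ext x
    have := h.φ_sq x (X x)
    rw [h.η_eq] at this
    exact this
  φ_ξ := by ext x; exact h.φ_ξ x
  g_φ X Y := by ext x; exact h.inner_φ x (X x) (Y x)
  nabla_φ_self X := by
    ext x
    exact sub_eq_zero.1 (h.covDerivEndo_self X X.contMDiff x)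

end AlmostContact

/-! ### Consequences of the contact condition -/

section NearlyCosymplectic

variable [T2Space M] {φ : Π x : M, TangentSpace I x →L[ℝ] TangentSpace I x}
  {ξ : Π x : M, TangentSpace I x} {η : Π x : M, TangentSpace I x →L[ℝ] ℝ}

namespace IsNearlyCosymplectic

theorem inner_leviCivita_ξ (hφ : IsNearlyCosymplectic φ ξ η) (x : M) (u v : TangentSpace I x) :
    (inner ℝ (leviCivita ξ x u) v : ℝ) = -inner ℝ u (leviCivita ξ x v) := by
  obtain ⟨X, rfl⟩ := exists_smoothField u
  obtain ⟨Y, rfl⟩ := exists_smoothField v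
  exact congrArg (fun f : SmoothFun I M => f x) (hφ.calculus.g_h X Y)

theorem leviCivita_ξ_φ (hφ : IsNearlyCosymplectic φ ξ η) (x : M) (u : TangentSpace I x) :
    leviCivita ξ x (φ x u) = -φ x (leviCivita ξ x u) := by
  obtain ⟨X, rfl⟩ := exists_smoothField u
  exact congrArg (fun f : SmoothField I M => f x) (hφ.calculus.h_φ X)

theorem leviCivita_ξ_ξ (hφ : IsNearlyCosymplectic φ ξ η) (x : M) : leviCivita ξ x (ξ x) = 0 :=
  congrArg (fun f : SmoothField I M => f x) hφ.calculus.h_ξ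

/-- Metric compatibility and zero torsion give `dη(u,v) = (g(∇_u ξ, v) - g(∇_v ξ, u))/2`; the
Killing property makes both terms contribute equally, absorbing the factor 1/2. -/
theorem extDerivOneForm_eq (hφ : IsNearlyCosymplectic φ ξ η) (x : M) (u v : TangentSpace I x) :
    extDerivOneForm η x u v = inner ℝ (leviCivita ξ x u) v := by
  have hξ : MDiffAt (T% ξ) x := (hφ.smooth_ξ x).mdifferentiableAt (by simp)
  have hu : MDiffAt (T% (extend E u : Π y : M, TangentSpace I y)) x := mdifferentiableAt_extend ..
  have hv : MDiffAt (T% (extend E v : Π y : M, TangentSpace I y)) x := mdifferentiableAt_extend ..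
  have h₁ := leviCivita_metric hu hv hξ
  have h₂ := leviCivita_metric hv hu hξ
  have h₃ := (CovariantDerivative.torsion_eq_zero_iff _).1 leviCivita_torsion hu hv
  rw [extend_apply_self] at h₁ h₂
  rw [extend_apply_self, extend_apply_self] at h₃
  simp only [extDerivOneForm, hφ.η_eq]
  rw [h₁, h₂, ← h₃, inner_sub_left, extend_apply_self, extend_apply_self, real_inner_comm v]
  have := hφ.inner_leviCivita_ξ x u v
  rw [real_inner_comm] at this
  linear_combination -(1 / 2 : ℝ) * this

/-- `∇ξ` is injective on the contact distribution. -/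
theorem eq_zero_of_leviCivita_ξ_eq_zero (hφ : IsNearlyCosymplectic φ ξ η) {n : ℕ}
    (hE : Module.finrank ℝ E = 2 * n + 1) (hη : IsContactForm n η) {x : M}
    {u : TangentSpace I x} (hu : η x u = 0) (h : leviCivita ξ x u = 0) : u = 0 := by
  by_contra hu0
  obtain ⟨v, hv⟩ := hη.2 x
  let θ : TangentSpace I x →ₗ[ℝ] TangentSpace I x →ₗ[ℝ] ℝ :=
    LinearMap.mk₂ ℝ (fun v w => inner ℝ (leviCivita ξ x v) w)
      (fun v v' w => by rw [map_add, inner_add_left])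
      (fun a v w => by rw [map_smul, real_inner_smul_left, smul_eq_mul])
      (fun v w w' => inner_add_right _ _ _) (fun a v w => real_inner_smul_right _ _ _)
  have hθ : ∀ v w, θ v w = inner ℝ (leviCivita ξ x v) w := fun v w => rfl
  have hE' : Module.finrank ℝ (TangentSpace I x) = 2 * n + 1 := hE
  refine hv ?_
  have key := sum_formProd_eq_zero hE' (η x).toLinearMap θ hu0 hu
    (LinearMap.ext fun w => by rw [hθ, h, inner_zero_left]; rfl)
    (fun w => by rw [hθ, hφ.inner_leviCivita_ξ, h, inner_zero_right, neg_zero]) v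
  rw [← key, contactVolume]
  refine Finset.sum_congr rfl fun σ _ => ?_
  simp only [formProd, hφ.extDerivOneForm_eq, hθ]
  rfl

theorem exists_horizontal (hφ : IsNearlyCosymplectic φ ξ η) {x : M} {u : TangentSpace I x}
    (hu : η x u = 0) :
    ∃ X : SmoothField I M, hφ.calculus.Horizontal X ∧ X x = u := by
  obtain ⟨X, rfl⟩ := exists_smoothField u
  refine ⟨X - hφ.calculus.g X hφ.calculus.ξ • hφ.calculus.ξ, ?_, ?_⟩
  · simp [NearlyCosymplecticCalculus.Horizontal, hφ.calculus.g_ξ_ξ]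
  · have : X x - (inner ℝ (X x) (ξ x) : ℝ) • ξ x = X x := by
      rw [← hφ.η_eq, hu, zero_smul, sub_zero]
    exact this

theorem η_of_horizontal (hφ : IsNearlyCosymplectic φ ξ η) {X : SmoothField I M}
    (hX : hφ.calculus.Horizontal X) (x : M) :
    η x (X x) = 0 := by
  rw [hφ.η_eq]
  exact congrArg (fun f : SmoothFun I M => f x) hX

/-- If the 1-form is a contact form, `∇φ` maps horizontal vectors to vertical ones. -/
theorem T_eq_zero (hφ : IsNearlyCosymplectic φ ξ η) {n : ℕ}
    (hE : Module.finrank ℝ E = 2 * n + 1) (hη : IsContactForm n η)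
    (X Y Z : SmoothField I M) (hX : hφ.calculus.Horizontal X) (hY : hφ.calculus.Horizontal Y)
    (hZ : hφ.calculus.Horizontal Z) : hφ.calculus.T X Y Z = 0 := by
  ext x
  -- Adding `η ⊗ ξ` to `φh` preserves `η` and makes an injective endomorphism of the whole tangent
  -- space, so finite dimension gives surjectivity, and preimages of horizontal vectors are
  -- horizontal.
  let L : TangentSpace I x →ₗ[ℝ] TangentSpace I x :=
    ((φ x).comp (leviCivita ξ x) + (η x).smulRight (ξ x)).toLinearMap
  have hL : ∀ u, L u = φ x (leviCivita ξ x u) + η x u • ξ x := fun u => rfl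
  have hηL : ∀ u, η x (L u) = η x u := fun u => by
    rw [hL, map_add, map_smul, hφ.η_φ, hφ.η_ξ, smul_eq_mul, mul_one, zero_add]
  have hLinj : Function.Injective L := by
    refine (injective_iff_map_eq_zero L).2 fun u hu => ?_
    have hηu : η x u = 0 := by rw [← hηL, hu, map_zero]
    rw [hL, hηu, zero_smul, add_zero] at hu
    refine hφ.eq_zero_of_leviCivita_ξ_eq_zero hE hη hηu ?_
    have h₁ := hφ.φ_sq x (leviCivita ξ x u)
    rw [hu, map_zero, hφ.η_eq, hφ.inner_leviCivita_ξ, hφ.leviCivita_ξ_ξ, inner_zero_right,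
      neg_zero, zero_smul, add_zero, eq_comm, neg_eq_zero] at h₁
    exact h₁
  obtain ⟨u, hu⟩ := (LinearMap.injective_iff_surjective (f := L)).1 hLinj (Z x)
  have hηu : η x u = 0 := by rw [← hηL, hu, hφ.η_of_horizontal hZ]
  obtain ⟨W, hW, rfl⟩ := hφ.exists_horizontal hηu
  have key := congrArg (fun f : SmoothFun I M => f x) (NearlyCosymplecticCalculus.T_φ_h hX hY hW)
  rw [hL, hηu, zero_smul, add_zero] at hu
  change inner ℝ ((hφ.calculus.nabla X (hφ.calculus.φ Y)
    - hφ.calculus.φ (hφ.calculus.nabla X Y) : SmoothField I M) x) (Z x) = (0 : ℝ)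
  rw [← hu]
  exact key

end IsNearlyCosymplectic

end NearlyCosymplectic

/-! ### Constant sectional curvature on the contact distribution -/

/-- The vector `|v|²u - ⟨u,v⟩v` has squared norm `|v|²` times the Gram determinant. -/
theorem inner_mul_inner_sub_ne_zero {V : Type*} [NormedAddCommGroup V] [InnerProductSpace ℝ V]
    {u v : V} (h : LinearIndependent ℝ ![u, v]) :
    (inner ℝ u u * inner ℝ v v - inner ℝ u v ^ 2 : ℝ) ≠ 0 := fun h₀ => by
  have hw : (inner ℝ v v : ℝ) • u + (-inner ℝ u v : ℝ) • v = 0 := by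
    refine inner_self_eq_zero (𝕜 := ℝ).1 ?_
    simp only [inner_add_left, inner_add_right, real_inner_smul_left, real_inner_smul_right,
      real_inner_comm u v]
    linear_combination (inner ℝ v v : ℝ) * h₀
  exact h.ne_zero 1 (inner_self_eq_zero.1 (LinearIndependent.pair_iff.1 h _ _ hw).1)

section

variable [T2Space M] {φ : Π x : M, TangentSpace I x →L[ℝ] TangentSpace I x}
  {ξ : Π x : M, TangentSpace I x} {η : Π x : M, TangentSpace I x →L[ℝ] ℝ}

/-- Covers pairs dependent at `x`, about which a sectional curvature hypothesis says nothing. -/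
theorem R_eq_zero_of_eq_smul {ξ : SmoothField I M} (hξ : smoothMetric I M ξ ξ = 1)
    {X Y : SmoothField I M} {x : M} {a : ℝ} (h : X x = a • Y x) (Z W : SmoothField I M) :
    (smoothCalculus I M).R X Y Z W x = 0 := by
  let f : SmoothFun I M := ⟨fun _ => a, contMDiff_const⟩
  rw [R_congr hξ (X' := f • Y) (Y' := Y) (Z' := Z) (W' := W) h rfl rfl rfl,
    RiemannianCalculus.R_smul₁,
    RiemannianCalculus.eq_zero_of_two_mul (a := (smoothCalculus I M).R Y Y Z W)
      (by linear_combination (smoothCalculus I M).R_swap₁₂ Y Y Z W), mul_zero]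
  rfl

/-- The curvature tensor on a contact distribution of constant sectional curvature. -/
theorem IsNearlyCosymplectic.R_eq_of_sectionalCurvature_eq (hφ : IsNearlyCosymplectic φ ξ η)
    {x : M} {c : ℝ}
    (hc : ∀ u ∈ contactDistribution η x, ∀ v ∈ contactDistribution η x,
      LinearIndependent ℝ ![u, v] → sectionalCurvature u v = c)
    {X Y Z W : SmoothField I M} (hX : hφ.calculus.Horizontal X) (hY : hφ.calculus.Horizontal Y)
    (hZ : hφ.calculus.Horizontal Z) (hW : hφ.calculus.Horizontal W) :
    (smoothCalculus I M).R X Y Z W x =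
      c * (inner ℝ (Y x) (Z x) * inner ℝ (X x) (W x) -
        inner ℝ (X x) (Z x) * inner ℝ (Y x) (W x)) := by
  have hξ : smoothMetric I M hφ.calculus.ξ hφ.calculus.ξ = 1 := hφ.calculus.g_ξ_ξ
  set C := smoothCalculus I M
  have s₁₂ : ∀ X Y Z W, C.R X Y Z W x = -C.R Y X Z W x := fun X Y Z W =>
    congrArg (fun f : SmoothFun I M => f x) (C.R_swap₁₂ X Y Z W)
  have s₃₄ : ∀ X Y Z W, C.R X Y Z W x = -C.R X Y W Z x := fun X Y Z W =>
    congrArg (fun f : SmoothFun I M => f x) (C.R_swap₃₄ hξ X Y Z W)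
  have hpair : ∀ X Y Z W, C.R X Y Z W x = C.R Z W X Y x := fun X Y Z W =>
    congrArg (fun f : SmoothFun I M => f x) (C.R_pair hξ X Y Z W)
  have hbianchi : ∀ X Y Z W, C.R X Y Z W x + C.R Y Z X W x + C.R Z X Y W x = 0 := fun X Y Z W =>
    congrArg (fun f : SmoothFun I M => f x) (C.R_bianchi X Y Z W)
  have hadd : ∀ X X' Y Z W, C.R (X + X') Y Z W x = C.R X Y Z W x + C.R X' Y Z W x :=
    fun X X' Y Z W => congrArg (fun f : SmoothFun I M => f x) (C.R_add₁ X X' Y Z W)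
  -- Subtract the constant curvature model; the difference is curvature-like with zero sectional
  -- curvatures on horizontal fields.
  refine sub_eq_zero.1 (eq_zero_of_sectional_eq_zero (P := hφ.calculus.Horizontal)
    (B := fun X Y Z W => C.R X Y Z W x -
      c * (inner ℝ (Y x) (Z x) * inner ℝ (X x) (W x) -
        inner ℝ (X x) (Z x) * inner ℝ (Y x) (W x))) ?_ ?_ ?_ ?_ ?_ ?_ ?_ hX hY hZ hW)
  · intro X Y hX hY
    rw [NearlyCosymplecticCalculus.Horizontal] at hX hY ⊢
    rw [map_add, LinearMap.add_apply, hX, hY, add_zero]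
  · intro X X' Y Z W
    have e : (X + X') x = X x + X' x := rfl
    simp only [hadd, e, inner_add_left]
    ring
  · intro X Y Z W
    linear_combination s₁₂ X Y Z W
  · intro X Y Z W
    linear_combination s₃₄ X Y Z W
  · intro X Y Z W
    simp only [real_inner_comm (Z x) (Y x), real_inner_comm (W x) (X x),
      real_inner_comm (Z x) (X x), real_inner_comm (W x) (Y x)]
    linear_combination hpair X Y Z W
  · intro X Y Z W
    simp only [real_inner_comm (Z x) (Y x), real_inner_comm (Z x) (X x),
      real_inner_comm (Y x) (X x)]
    linear_combination hbianchi X Y Z W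
  · intro X Y hX hY
    by_cases hli : LinearIndependent ℝ ![X x, Y x]
    · have h := hc _ (hφ.η_of_horizontal hX x) _ (hφ.η_of_horizontal hY x) hli
      rw [sectionalCurvature, div_eq_iff (inner_mul_inner_sub_ne_zero hli), ← R_apply hξ] at h
      simp only [real_inner_comm (X x) (Y x)]
      linear_combination (norm := (simp only [C]; ring)) h
    · have hdep : (∃ a : ℝ, X x = a • Y x) ∨ ∃ a : ℝ, Y x = a • X x := by
        by_cases h : X x = 0
        · exact Or.inl ⟨0, by rw [h, zero_smul]⟩
        · rw [LinearIndependent.pair_iff' h] at hli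
          push Not at hli
          exact Or.inr (hli.imp fun a h => h.symm)
      obtain ⟨a, ha⟩ | ⟨a, ha⟩ := hdep
      · simp only [R_eq_zero_of_eq_smul hξ ha, ha, real_inner_smul_left, real_inner_smul_right, C]
        ring
      · rw [s₁₂]
        simp only [R_eq_zero_of_eq_smul hξ ha, ha, real_inner_smul_left, real_inner_smul_right, C]
        ring

theorem IsNearlyCosymplectic.finrank_eq_five (hφ : IsNearlyCosymplectic φ ξ η) {n : ℕ} (hn : 1 ≤ n)
    (hE : Module.finrank ℝ E = 2 * n + 1) (hη : IsContactForm n η) {x : M} {c : ℝ}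
    (hc : ∀ u ∈ contactDistribution η x, ∀ v ∈ contactDistribution η x,
      LinearIndependent ℝ ![u, v] → sectionalCurvature u v = c) :
    c ≠ 0 ∧ Module.finrank ℝ E = 5 := by
  have hE' : Module.finrank ℝ (TangentSpace I x) = 2 * n + 1 := hE
  refine finrank_eq_five_of_curvature_identity (V := TangentSpace I x) (φ x).toLinearMap
    (leviCivita ξ x).toLinearMap (ξ := ξ x) (by rw [hE']; omega)
    (by rw [← hφ.η_eq, hφ.η_ξ]) (hφ.φ_ξ x) (hφ.leviCivita_ξ_ξ x) (hφ.inner_φ x)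
    (hφ.inner_leviCivita_ξ x) (hφ.leviCivita_ξ_φ x) (fun u hu => ?_)
    (fun u hu h => hφ.eq_zero_of_leviCivita_ξ_eq_zero hE hη (by rw [hφ.η_eq, hu]) h)
    (fun u w hu hw => ?_)
  · rw [← hφ.η_eq] at hu
    have := hφ.φ_sq x u
    rw [hu, zero_smul, add_zero] at this
    exact this
  · rw [← hφ.η_eq] at hu hw
    obtain ⟨X, hX, rfl⟩ := hφ.exists_horizontal hu
    obtain ⟨W, hW, rfl⟩ := hφ.exists_horizontal hw
    -- Substituting the constant curvature form into this identity gives the required relation; the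
    -- term `R(W,X,φX,φW)` becomes `c⟨X,φW⟩²` since `⟨X,φX⟩ = 0`.
    have h₁ := congrArg (fun f : SmoothFun I M => f x)
      (NearlyCosymplecticCalculus.R_sub_R_φ (hφ.T_eq_zero hE hη) hX hW)
    have h₂ : (smoothCalculus I M).R W X X W x -
        (smoothCalculus I M).R W X (hφ.calculus.φ X) (hφ.calculus.φ W) x =
        inner ℝ (X x) (leviCivita ξ x (W x)) ^ 2 +
          inner ℝ (X x) (φ x (leviCivita ξ x (W x))) ^ 2 := h₁
    have e : ∀ X, hφ.calculus.φ X x = φ x (X x) := fun X => rfl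
    rw [hφ.R_eq_of_sectionalCurvature_eq hc hW hX hX hW,
      hφ.R_eq_of_sectionalCurvature_eq hc hW hX (hφ.calculus.horizontal_φ X)
        (hφ.calculus.horizontal_φ W), e, e] at h₂
    have h₃ := hφ.inner_φ x (X x) (X x)
    have h₄ := hφ.inner_φ x (X x) (W x)
    rw [real_inner_comm] at h₃ h₄
    refine Eq.trans ?_ h₂
    change c * (inner ℝ (X x) (X x) * inner ℝ (W x) (W x) - inner ℝ (X x) (W x) ^ 2
      - inner ℝ (X x) (φ x (W x)) ^ 2) = _
    have h₅ : (inner ℝ (X x) (φ x (X x)) : ℝ) = 0 := by linarith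
    rw [h₄, h₅, real_inner_comm (X x) (W x)]
    ring

end

end RiemGeom

end

theorem mainTheorem2 (n : ℕ) (hn : 1 ≤ n)
    {M : Type*} [TopologicalSpace M] [T2Space M] [SecondCountableTopology M]
    [ChartedSpace (EuclideanSpace ℝ (Fin (2 * n + 1))) M] [IsManifold (𝓡 (2 * n + 1)) ∞ M]
    [RiemannianBundle (fun x : M => TangentSpace (𝓡 (2 * n + 1)) x)]
    [IsContMDiffRiemannianBundle (𝓡 (2 * n + 1)) ∞ (EuclideanSpace ℝ (Fin (2 * n + 1)))
      (fun x : M => TangentSpace (𝓡 (2 * n + 1)) x)]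
    (φ : Π x : M, TangentSpace (𝓡 (2 * n + 1)) x →L[ℝ] TangentSpace (𝓡 (2 * n + 1)) x)
    (ξ : Π x : M, TangentSpace (𝓡 (2 * n + 1)) x)
    (η : Π x : M, TangentSpace (𝓡 (2 * n + 1)) x →L[ℝ] ℝ)
    (hη : RiemGeom.IsContactForm n η)
    (hφ : RiemGeom.IsNearlyCosymplectic φ ξ η) :
    (∀ (p : M) (c : ℝ),
      (∀ u ∈ RiemGeom.contactDistribution η p, ∀ v ∈ RiemGeom.contactDistribution η p,
        LinearIndependent ℝ ![u, v] → RiemGeom.sectionalCurvature u v = c) →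
      c ≠ 0 ∧ 2 * n + 1 = 5) ∧
    (Nonempty M → ¬ RiemGeom.IsFlat (𝓡 (2 * n + 1)) M) := by
  have main : ∀ (p : M) (c : ℝ),
      (∀ u ∈ RiemGeom.contactDistribution η p, ∀ v ∈ RiemGeom.contactDistribution η p,
        LinearIndependent ℝ ![u, v] → RiemGeom.sectionalCurvature u v = c) →
      c ≠ 0 ∧ 2 * n + 1 = 5 := fun p c hc => by
    have hE := finrank_euclideanSpace_fin (𝕜 := ℝ) (n := 2 * n + 1)
    rw [← hE]
    exact hφ.finrank_eq_five hn hE hη hc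
  refine ⟨main, fun ⟨p⟩ hflat => (main p 0 fun u _ v _ _ => ?_).1 rfl⟩
  rw [RiemGeom.sectionalCurvature, hflat p u v v, inner_zero_left, zero_div]
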